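/- Let $H$ be a separable complex Hilbert space (of finite or infinite dimension), let $\varepsilon\in[0,1]$, and let $\mathcal S=\{(p_m,\rho_m)\}_{m=1}^M$ be an ensemble of $M$ quantum states: $p_m>0$, $\sum_{m}p_m=1$, and each $\rho_m$ is a positive semidefinite operator on $H$ with $\operatorname{Tr}\rho_m=1$. For $n\in\{1,2,\dots\}$ let $$p_e(\mathcal S,n)=\inf_{(\Lambda_1,\dots,\Lambda_M)}\ \sum_{m=1}^M p_m\operatorname{Tr}\big[(I-\Lambda_m)\,\rho_m^{\otimes n}\big],$$ where the infimum is over all tuples of bounded operators $\Lambda_m\ge 0$ on $H^{\otimes n}$ with $\sum_m\Lambda_m=I$ (measurements), and let $$n^*(\mathcal S,\varepsilon)=\inf\{n\in\{1,2,\dots\}:\ p_e(\mathcal S,n)\le\varepsilon\}\in\{1,2,\dots\}\cup\{\infty\},\qquad \inf\emptyset=\infty.$$ Let $F(\rho,\sigma)=\|\sqrt\rho\sqrt\sigma\|_1^2$ be the fidelity, where $\|X\|_1=\operatorname{Tr}\sqrt{X^\dagger X}$. Then $$\max_{m\ne\bar m}\frac{\ln\!\Big(\frac{p_m p_{\bar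 m}}{(p_m+p_{\bar m})\,\varepsilon}\Big)}{-\ln F(\rho_m,\rho_{\bar m})}\ \le\ n^*(\mathcal S,\varepsilon)\ \le\ N:=\max\left\{1,\ \left\lceil\max_{m\ne\bar m}\frac{2\ln\!\Big(\frac{M(M-1)\sqrt{p_m}\sqrt{p_{\bar m}}}{2\varepsilon}\Big)}{-\ln F(\rho_m,\rho_{\bar m})}\right\rceil\right\}.$$ Here the quotients are taken in $[-\infty,\infty]$, with $\ln(c/0)=\infty$ for $c>0$, $-\ln 0=\infty$, $x/\infty=0$ for every $x\in[-\infty,\infty]$, $x/0=\infty$ for $x>0$, $x/0=-\infty$ for $x<0$ and $0/0=0$; a maximum over the empty set (the case $M=1$) is $-\infty$, and $\lceil\pm\infty\rceil=\pm\infty$. Moreover, the upper bound is achieved by the pretty-good measurement: for every finite $n\ge N$, with $A_m=p_m\rho_m^{\otimes n}$ and $S=\sum_m A_m$, the pretty-good measurement $\Lambda_m=S^{-1/2}A_mS^{-1/2}$ (the inverse square root being taken on the support of $S$, and the projection onto the kernel of $S$ being split among the outcomes in any way that makes $(\Lambda_1,\dots,\Lambda_M)$ a measurement) exists and has error probability $\sum_m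 p_m\operatorname{Tr}[(I-\Lambda_m)\rho_m^{\otimes n}]\le\varepsilon$. -/

import Mathlib

open scoped TensorProduct

universe u

noncomputable section

/-! ### Hilbert tensor products and tensor powers -/

/-- A bundled complex Hilbert space. -/
structure HilbertSp : Type (u + 1) where
  carrier : Type u
  [nacg : NormedAddCommGroup carrier]
  [ips : InnerProductSpace ℂ carrier]
  [complete : CompleteSpace carrier]

attribute [instance] HilbertSp.nacg HilbertSp.ips HilbertSp.complete

/-- The Hilbert tensor product: the completion of the algebraic tensor product for the inner
product `⟪x ⊗ y, x' ⊗ y'⟫ = ⟪x, x'⟫ ⟪y, y'⟫`. -/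
abbrev HilbertTensor (H K : Type u) [NormedAddCommGroup H] [InnerProductSpace ℂ H]
    [NormedAddCommGroup K] [InnerProductSpace ℂ K] : Type u :=
  UniformSpace.Completion (H ⊗[ℂ] K)

/-- The tensor product `A ⊗ B` of two bounded operators: the continuous extension of
`x ⊗ y ↦ A x ⊗ B y`. -/
def opTensor {H K : Type u} [NormedAddCommGroup H] [InnerProductSpace ℂ H]
    [NormedAddCommGroup K] [InnerProductSpace ℂ K] (A : H →L[ℂ] H) (B : K →L[ℂ] K) :
    HilbertTensor H K →L[ℂ] HilbertTensor H K :=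
  (TensorProduct.mapL A B).completion

/-- The `n`-fold Hilbert tensor power `H^{⊗ n}`; the zeroth one is one-dimensional. -/
def tensorPow (H : Type u) [NormedAddCommGroup H] [InnerProductSpace ℂ H] : ℕ → HilbertSp.{u}
  | 0 => ⟨EuclideanSpace ℂ PUnit.{u + 1}⟩
  | n + 1 => ⟨HilbertTensor H (tensorPow H n).carrier⟩

/-- Bounded operators on `H^{⊗ n}`. -/
abbrev OpPow (H : Type u) [NormedAddCommGroup H] [InnerProductSpace ℂ H] (n : ℕ) : Type u :=
  (tensorPow H n).carrier →L[ℂ] (tensorPow H n).carrier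

/-- The tensor power `A^{⊗ n}` of a bounded operator, acting on `H^{⊗ n}`. -/
def opPow {H : Type u} [NormedAddCommGroup H] [InnerProductSpace ℂ H] (A : H →L[ℂ] H) :
    (n : ℕ) → OpPow H n
  | 0 => 1
  | n + 1 => opTensor A (opPow A n)

/-! ### Trace, states, fidelity -/

section Hilbert

variable {H : Type u} [NormedAddCommGroup H] [InnerProductSpace ℂ H] [CompleteSpace H]

/-- The trace `∑ i, ⟪e i, T (e i)⟫` over an orthonormal basis `e` of `H`. For the trace-class
operators to which it is applied below, the sum converges absolutely and does not depend on the
basis. -/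
def opTrace (T : H →L[ℂ] H) : ℂ :=
  ∑' i, inner ℂ ((exists_hilbertBasis ℂ H).choose_spec.choose i)
    (T ((exists_hilbertBasis ℂ H).choose_spec.choose i))

/-- The trace norm `‖T‖₁ = Tr √(T† T)`. -/
def traceNorm (T : H →L[ℂ] H) : ℝ :=
  (opTrace (CFC.sqrt (star T * T))).re

/-- A quantum state: a positive semidefinite operator of trace one. (A positive operator whose
diagonal is not summable gets the trace `0` and is not a state.) -/
def IsState (ρ : H →L[ℂ] H) : Prop :=
  0 ≤ ρ ∧ opTrace ρ = 1

/-- The fidelity `F(ρ, σ) = ‖√ρ √σ‖₁²`. -/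
def fidelity (ρ σ : H →L[ℂ] H) : ℝ :=
  traceNorm (CFC.sqrt ρ * CFC.sqrt σ) ^ 2

/-- An `M`-outcome positive operator-valued measure. -/
def IsPOVM {M : ℕ} (Λ : Fin M → H →L[ℂ] H) : Prop :=
  (∀ m, 0 ≤ Λ m) ∧ ∑ m, Λ m = 1

/-- `E m = S^{-1/2} A m S^{-1/2}` for all `m`, where `S = ∑ m, A m` and the inverse square root is
taken on the support of `S`: the operators `E m` are positive, vanish on the kernel of `S`, and
satisfy `S^{1/2} E m S^{1/2} = A m`. These conditions determine `E m`. -/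
def IsPrettyGoodTuple {M : ℕ} (A E : Fin M → H →L[ℂ] H) : Prop :=
  ∀ m, 0 ≤ E m ∧ (∀ x, (∑ j, A j) x = 0 → E m x = 0) ∧
    CFC.sqrt (∑ j, A j) * E m * CFC.sqrt (∑ j, A j) = A m

/-- A pretty-good measurement for the tuple `A`: a measurement `Λ` with
`Λ m = S^{-1/2} A m S^{-1/2}` up to a splitting of the projection onto the kernel of
`S = ∑ m, A m` among the outcomes. -/
def IsPrettyGoodMeasurement {M : ℕ} (A Λ : Fin M → H →L[ℂ] H) : Prop :=
  IsPOVM Λ ∧ ∃ E : Fin M → H →L[ℂ] H, IsPrettyGoodTuple A E ∧ ∀ m, E m ≤ Λ m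

end Hilbert

/-! ### Multiple quantum hypothesis testing -/

/-- An ensemble `{(p_m, ρ_m)}` of `M` states on `H` with positive prior probabilities. -/
structure QEnsemble (H : Type u) [NormedAddCommGroup H] [InnerProductSpace ℂ H]
    [CompleteSpace H] (M : ℕ) where
  p : Fin M → ℝ
  ρ : Fin M → H →L[ℂ] H
  p_pos : ∀ m, 0 < p m
  p_sum : ∑ m, p m = 1
  isState : ∀ m, IsState (ρ m)

namespace QEnsemble

variable {H : Type u} [NormedAddCommGroup H] [InnerProductSpace ℂ H] [CompleteSpace H] {M : ℕ}

/-- The error probability `∑ m, p_m Tr[(I - Λ_m) ρ_m^{⊗ n}]` of a measurement `Λ` of `n` copies. -/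
def errorProb (S : QEnsemble H M) (n : ℕ) (Λ : Fin M → OpPow H n) : ℝ :=
  ∑ m, S.p m * (opTrace ((1 - Λ m) * opPow (S.ρ m) n)).re

/-- The minimum error probability `p_e(S, n)`: the infimum over all POVMs. -/
def minErrorProb (S : QEnsemble H M) (n : ℕ) : ℝ :=
  sInf {e : ℝ | ∃ Λ : Fin M → OpPow H n, IsPOVM Λ ∧ e = S.errorProb n Λ}

/-- The sample complexity `n*(S, ε) = inf {n ∈ {1, 2, …} : p_e(S, n) ≤ ε}`, with `inf ∅ = ∞`. -/
def sampleComplexity (S : QEnsemble H M) (ε : ℝ) : ℕ∞ :=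
  sInf ((fun n : ℕ => (n : ℕ∞)) '' {n : ℕ | 1 ≤ n ∧ S.minErrorProb n ≤ ε})

/-- `Λ` is a pretty-good measurement for the ensemble `{(p_m, ρ_m^{⊗ n})}`. -/
def IsPGM (S : QEnsemble H M) (n : ℕ) (Λ : Fin M → OpPow H n) : Prop :=
  IsPrettyGoodMeasurement (fun m => (S.p m : ℂ) • opPow (S.ρ m) n) Λ

/-- The quotient `x / y` in `[-∞, ∞]` for `y ∈ [0, ∞]`, with `x / ∞ = 0` for every `x`,
`x / 0 = ±∞` according to the sign of `x ≠ 0`, and `0 / 0 = 0`. -/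
def quot (x y : EReal) : EReal :=
  if y = 0 then x * ⊤ else x / y

/-- `max_{m ≠ m'} ln (p_m p_m' / ((p_m + p_m') ε)) / (- ln F(ρ_m, ρ_m'))`, in `[-∞, ∞]`. -/
def lowerBound (S : QEnsemble H M) (ε : ℝ) : EReal :=
  ⨆ (m : Fin M) (m' : Fin M) (_ : m ≠ m'),
    quot
      (ENNReal.log (ENNReal.ofReal (S.p m * S.p m') / ENNReal.ofReal ((S.p m + S.p m') * ε)))
      (-ENNReal.log (ENNReal.ofReal (fidelity (S.ρ m) (S.ρ m'))))

/-- `max_{m ≠ m'} 2 ln (M (M - 1) √p_m √p_m' / (2 ε)) / (- ln F(ρ_m, ρ_m'))`, in `[-∞, ∞]`. -/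
def upperRatio (S : QEnsemble H M) (ε : ℝ) : EReal :=
  ⨆ (m : Fin M) (m' : Fin M) (_ : m ≠ m'),
    quot
      (2 * ENNReal.log (ENNReal.ofReal ((M : ℝ) * ((M : ℝ) - 1) * √(S.p m) * √(S.p m')) /
        ENNReal.ofReal (2 * ε)))
      (-ENNReal.log (ENNReal.ofReal (fidelity (S.ρ m) (S.ρ m'))))

/-- `max {1, ⌈upperRatio⌉}`; passing to `[0, ∞]` first replaces negative ratios by `0`, which does
not change this maximum. -/
def upperBound (S : QEnsemble H M) (ε : ℝ) : ℕ∞ :=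
  max 1 (ENat.ceil (S.upperRatio ε).toENNReal)

end QEnsemble

end

/-! Put `a_m = (√ρ_m)^{⊗n}`. Square roots and absolute values commute with tensor powers, so `‖a_m
a_j‖₁ = F(ρ_m, ρ_j)^{n/2}` (`traceNorm_opPow_mul`), and both bounds reduce to estimates for a single
measurement of `n` copies.

Lower bound: for `m ≠ j`, insert `1 = (1 - Λ_m) + Λ_m` between `a_m` and `a_j`. Cauchy–Schwarz and
`Λ_m ≤ 1 - Λ_j` give `F^{n/2} ≤ √X + √Y`, where `X`, `Y` are the error probabilities given `m` and
given `j`. A weighted Cauchy–Schwarz turns this into `p_m p_j F^n ≤ (p_m + p_j) p_e`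
(`QEnsemble.mul_overlap_pow_le_errorProb`).

Upper bound: let `s = √S`, let `E_j = S^{-1/2} A_j S^{-1/2}`, and put `x = √E_m`, `y = √(∑_{j≠m}
E_j)`. The `m`-th error term is at most `‖x s y‖₂²`. The key estimate `2‖x s y‖₂² ≤ ‖x s² y‖₁` is
`exists_two_mul_hsq_le`, with the trace norm replaced by a pairing with a contraction. Since `s √E_j
= √A_j U_j` with contractions `U_j`, the right side is at most `∑_{j≠m} ‖√A_m √A_j‖₁`
(`IsPrettyGoodMeasurement.re_opTrace_le`). For `n ≥ N` each of the `M(M-1)` summands of the total is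
at most `2ε / (M(M-1))`.

To cover infinite dimension, all traces are written as Hilbert–Schmidt inner products `hs` or
squared norms `hsq`. -/

/-! ### Hilbert–Schmidt operators and their inner product. -/

section HilbertSchmidt

open scoped ENNReal

variable {H : Type u} [NormedAddCommGroup H] [InnerProductSpace ℂ H]

theorem HilbertBasis.tsum_enorm_inner_sq {ι : Type*} (b : HilbertBasis ι ℂ H) (x : H) :
    ∑' i, ‖inner ℂ (b i) x‖ₑ ^ 2 = ‖x‖ₑ ^ 2 := by
  have h := b.hasSum_inner_mul_inner x x
  have h2 : HasSum (fun i => ‖inner ℂ (b i) x‖ ^ 2) (‖x‖ ^ 2) := by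
    have h3 := Complex.hasSum_re h
    rw [show (‖x‖ ^ 2 : ℝ) = (inner ℂ x x : ℂ).re from (inner_self_eq_norm_sq (𝕜 := ℂ) x).symm]
    convert h3 using 2 with i
    rw [← inner_conj_symm x (b i), ← Complex.normSq_eq_conj_mul_self, Complex.ofReal_re,
      Complex.normSq_eq_norm_sq]
  have h4 := ENNReal.ofReal_tsum_of_nonneg (fun i => sq_nonneg ‖inner ℂ (b i) x‖) h2.summable
  rw [h2.tsum_eq] at h4
  simpa [ENNReal.ofReal_pow, ofReal_norm] using h4.symm

variable [CompleteSpace H]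

/-- The squared Hilbert–Schmidt norm of `A`, computed in the basis `b`, with values in `[0, ∞]`. -/
noncomputable def hsENorm {ι : Type*} (b : HilbertBasis ι ℂ H) (A : H →L[ℂ] H) : ℝ≥0∞ :=
  ∑' i, ‖A (b i)‖ₑ ^ 2

/-- Parseval in each basis and an exchange of sums, legitimate in `[0, ∞]` without summability.
Allowing two different bases makes basis independence a corollary. -/
theorem hsENorm_star {ι κ : Type*} (b : HilbertBasis ι ℂ H) (b' : HilbertBasis κ ℂ H)
    (A : H →L[ℂ] H) : hsENorm b (star A) = hsENorm b' A := by
  unfold hsENorm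
  simp_rw [← b'.tsum_enorm_inner_sq (star A _), ← b.tsum_enorm_inner_sq (A _)]
  rw [ENNReal.tsum_comm]
  refine tsum_congr fun j => tsum_congr fun i => ?_
  rw [ContinuousLinearMap.star_eq_adjoint, ContinuousLinearMap.adjoint_inner_right,
    ← inner_conj_symm (A _), ← ofReal_norm, ← ofReal_norm, RCLike.norm_conj]

theorem hsENorm_basis_indep {ι κ : Type*} (b : HilbertBasis ι ℂ H) (b' : HilbertBasis κ ℂ H)
    (A : H →L[ℂ] H) : hsENorm b A = hsENorm b' A := by
  rw [← hsENorm_star b b, hsENorm_star b b']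

variable (H) in
/-- The index type of `traceBasis`. -/
noncomputable def traceIndex : Set H := (exists_hilbertBasis ℂ H).choose

variable (H) in
/-- The Hilbert basis used by `opTrace`. -/
noncomputable def traceBasis : HilbertBasis (traceIndex H) ℂ H :=
  (exists_hilbertBasis ℂ H).choose_spec.choose

/-- `A` is a Hilbert–Schmidt operator. -/
noncomputable def IsHS (A : H →L[ℂ] H) : Prop := Summable fun i => ‖A (traceBasis H i)‖ ^ 2

/-- The squared Hilbert–Schmidt norm. -/
noncomputable def hsq (A : H →L[ℂ] H) : ℝ := ∑' i, ‖A (traceBasis H i)‖ ^ 2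

/-- The real part of the Hilbert–Schmidt inner product. -/
noncomputable def hs (A B : H →L[ℂ] H) : ℝ := ∑' i, (inner ℂ (A (traceBasis H i)) (B (traceBasis H i))).re

theorem re_opTrace {T : H →L[ℂ] H}
    (h : Summable fun i => (inner ℂ (traceBasis H i) (T (traceBasis H i)))) :
    (opTrace T).re = ∑' i, (inner ℂ (traceBasis H i) (T (traceBasis H i))).re :=
  Complex.re_tsum h

theorem hsENorm_traceBasis (A : H →L[ℂ] H) :
    hsENorm (traceBasis H) A = ∑' i, ENNReal.ofReal (‖A (traceBasis H i)‖ ^ 2) := by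
  simp [hsENorm, ENNReal.ofReal_pow]

theorem isHS_iff (A : H →L[ℂ] H) : IsHS A ↔ hsENorm (traceBasis H) A ≠ ⊤ := by
  rw [hsENorm_traceBasis]
  refine ⟨fun h => h.tsum_ofReal_ne_top, fun h => ?_⟩
  have := ENNReal.summable_toReal h
  simpa [IsHS, ENNReal.toReal_ofReal] using this

theorem hsq_eq_toReal (A : H →L[ℂ] H) : hsq A = (hsENorm (traceBasis H) A).toReal := by
  rw [hsENorm_traceBasis, ENNReal.tsum_toReal_eq (fun _ => ENNReal.ofReal_ne_top)]
  simp [hsq]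

theorem hsq_nonneg (A : H →L[ℂ] H) : 0 ≤ hsq A := tsum_nonneg fun _ => sq_nonneg _

theorem IsHS.star {A : H →L[ℂ] H} (h : IsHS A) : IsHS (star A) := by
  rw [isHS_iff, hsENorm_star _ (traceBasis H)]
  exact (isHS_iff A).1 h

theorem hsq_star (A : H →L[ℂ] H) : hsq (star A) = hsq A := by
  rw [hsq_eq_toReal, hsENorm_star _ (traceBasis H), ← hsq_eq_toReal]

theorem IsHS.mul_left {A : H →L[ℂ] H} (h : IsHS A) (Z : H →L[ℂ] H) : IsHS (Z * A) := by
  refine Summable.of_nonneg_of_le (fun _ => sq_nonneg _) (fun i => ?_) (Summable.mul_left (‖Z‖ ^ 2) h)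
  rw [← mul_pow]
  exact pow_le_pow_left₀ (norm_nonneg _) (Z.le_opNorm _) 2

theorem IsHS.mul_right {A : H →L[ℂ] H} (h : IsHS A) (Z : H →L[ℂ] H) : IsHS (A * Z) := by
  simpa using (h.star.mul_left (Star.star Z)).star

theorem hsq_mul_left_le {A : H →L[ℂ] H} (h : IsHS A) {Z : H →L[ℂ] H} (hZ : ‖Z‖ ≤ 1) :
    hsq (Z * A) ≤ hsq A := by
  refine (h.mul_left Z).tsum_le_tsum (fun i => ?_) h
  refine pow_le_pow_left₀ (norm_nonneg _) ((Z.le_opNorm _).trans ?_) 2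
  exact mul_le_of_le_one_left (norm_nonneg _) hZ

theorem hsq_mul_right_le {A : H →L[ℂ] H} (h : IsHS A) {Z : H →L[ℂ] H} (hZ : ‖Z‖ ≤ 1) :
    hsq (A * Z) ≤ hsq A := by
  rw [← hsq_star, star_mul, ← hsq_star A]
  exact hsq_mul_left_le h.star (by rwa [norm_star])

theorem IsHS.summable_inner {A B : H →L[ℂ] H} (hA : IsHS A) (hB : IsHS B) :
    Summable fun i => (inner ℂ (A (traceBasis H i)) (B (traceBasis H i)) : ℂ) := by
  refine Summable.of_norm_bounded (Summable.add hA hB) fun i => ?_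
  refine (norm_inner_le_norm _ _).trans ?_
  nlinarith [sq_nonneg (‖A (traceBasis H i)‖ - ‖B (traceBasis H i)‖),
    sq_nonneg (‖A (traceBasis H i)‖), sq_nonneg (‖B (traceBasis H i)‖)]

theorem IsHS.summable_re {A B : H →L[ℂ] H} (hA : IsHS A) (hB : IsHS B) :
    Summable fun i => (inner ℂ (A (traceBasis H i)) (B (traceBasis H i)) : ℂ).re :=
  Complex.reCLM.summable (hA.summable_inner hB)

theorem hs_self (A : H →L[ℂ] H) : hs A A = hsq A :=
  tsum_congr fun _ => inner_self_eq_norm_sq (𝕜 := ℂ) _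

theorem hs_comm (A B : H →L[ℂ] H) : hs A B = hs B A :=
  tsum_congr fun _ => inner_re_symm (𝕜 := ℂ) _ _

theorem IsHS.add {A B : H →L[ℂ] H} (hA : IsHS A) (hB : IsHS B) : IsHS (A + B) := by
  refine Summable.of_nonneg_of_le (fun _ => sq_nonneg _) (fun i => ?_)
    ((Summable.mul_left 2 hA).add (Summable.mul_left 2 hB))
  have h := norm_add_le (A (traceBasis H i)) (B (traceBasis H i))
  have h0 := norm_nonneg (A (traceBasis H i) + B (traceBasis H i))
  simp only [add_apply]
  nlinarith [sq_nonneg (‖A (traceBasis H i)‖ - ‖B (traceBasis H i)‖)]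

theorem IsHS.neg {A : H →L[ℂ] H} (hA : IsHS A) : IsHS (-A) := by
  simpa [IsHS] using hA

theorem IsHS.sub {A B : H →L[ℂ] H} (hA : IsHS A) (hB : IsHS B) : IsHS (A - B) := by
  rw [sub_eq_add_neg]
  exact hA.add hB.neg

theorem IsHS.smul {A : H →L[ℂ] H} (hA : IsHS A) (c : ℂ) : IsHS (c • A) := by
  simpa [IsHS, norm_smul, mul_pow] using Summable.mul_left (‖c‖ ^ 2) hA

theorem IsHS.zero : IsHS (0 : H →L[ℂ] H) := by simp [IsHS, summable_zero]

theorem IsHS.sum {ι : Type*} (s : Finset ι) {A : ι → H →L[ℂ] H} (h : ∀ i ∈ s, IsHS (A i)) :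
    IsHS (∑ i ∈ s, A i) := by
  classical
  induction s using Finset.induction_on with
  | empty => simpa using IsHS.zero
  | insert a s ha ih =>
    rw [Finset.sum_insert ha]
    exact (h a (Finset.mem_insert_self a s)).add
      (ih fun i hi => h i (Finset.mem_insert_of_mem hi))

theorem hs_add_left {A B C : H →L[ℂ] H} (hA : IsHS A) (hB : IsHS B) (hC : IsHS C) :
    hs (A + B) C = hs A C + hs B C := by
  unfold hs
  rw [← (hA.summable_re hC).tsum_add (hB.summable_re hC)]
  simp

theorem hs_add_right {A B C : H →L[ℂ] H} (hA : IsHS A) (hB : IsHS B) (hC : IsHS C) :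
    hs A (B + C) = hs A B + hs A C := by
  rw [hs_comm, hs_add_left hB hC hA, hs_comm B, hs_comm C]

theorem hs_neg_right (A B : H →L[ℂ] H) : hs A (-B) = -hs A B := by
  simp [hs, tsum_neg]

theorem hs_sub_right {A B C : H →L[ℂ] H} (hA : IsHS A) (hB : IsHS B) (hC : IsHS C) :
    hs A (B - C) = hs A B - hs A C := by
  rw [sub_eq_add_neg, hs_add_right hA hB hC.neg, hs_neg_right, sub_eq_add_neg]

theorem hs_sub_left {A B C : H →L[ℂ] H} (hA : IsHS A) (hB : IsHS B) (hC : IsHS C) :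
    hs (A - B) C = hs A C - hs B C := by
  rw [hs_comm, hs_sub_right hC hA hB, hs_comm A, hs_comm B]

theorem hs_zero_right (A : H →L[ℂ] H) : hs A 0 = 0 := by simp [hs]

theorem hs_sum_right {ι : Type*} (s : Finset ι) {A : H →L[ℂ] H} {B : ι → H →L[ℂ] H}
    (hA : IsHS A) (h : ∀ i ∈ s, IsHS (B i)) : hs A (∑ i ∈ s, B i) = ∑ i ∈ s, hs A (B i) := by
  classical
  induction s using Finset.induction_on with
  | empty => simp [hs_zero_right]
  | insert a s ha ih =>
    have h' : ∀ i ∈ s, IsHS (B i) := fun i hi => h i (Finset.mem_insert_of_mem hi)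
    rw [Finset.sum_insert ha, Finset.sum_insert ha,
      hs_add_right hA (h a (Finset.mem_insert_self a s)) (IsHS.sum s h'), ih h']

theorem hs_real_smul_left (c : ℝ) (A B : H →L[ℂ] H) : hs ((c : ℂ) • A) B = c * hs A B := by
  simp [hs, tsum_mul_left]

theorem hs_real_smul_right (c : ℝ) (A B : H →L[ℂ] H) : hs A ((c : ℂ) • B) = c * hs A B := by
  rw [hs_comm, hs_real_smul_left, hs_comm]

/-- Transfers invariance under the adjoint from `hsq` to `hs`. -/
theorem hs_eq_polarization {A B : H →L[ℂ] H} (hA : IsHS A) (hB : IsHS B) :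
    4 * hs A B = hsq (A + B) - hsq (A - B) := by
  rw [← hs_self, ← hs_self, hs_add_left hA hB (hA.add hB), hs_sub_left hA hB (hA.sub hB),
    hs_add_right hA hA hB, hs_add_right hB hA hB, hs_sub_right hA hA hB, hs_sub_right hB hA hB,
    hs_comm B A]
  ring

theorem hs_star_star {A B : H →L[ℂ] H} (hA : IsHS A) (hB : IsHS B) :
    hs (star A) (star B) = hs A B := by
  have h := hs_eq_polarization hA hB
  have h' := hs_eq_polarization hA.star hB.star
  rw [← star_add, ← star_sub, hsq_star, hsq_star, ← h] at h'
  linarith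

theorem hs_mul_left (Z A B : H →L[ℂ] H) : hs (Z * A) B = hs A (star Z * B) :=
  tsum_congr fun i => by
    simp [ContinuousLinearMap.star_eq_adjoint, ContinuousLinearMap.adjoint_inner_right]

theorem hs_mul_right {A B : H →L[ℂ] H} (hA : IsHS A) (hB : IsHS B) (Z : H →L[ℂ] H) :
    hs (A * Z) B = hs A (B * star Z) := by
  rw [← hs_star_star (hA.mul_right Z) hB, star_mul, hs_mul_left, star_star,
    ← hs_star_star hA (hB.mul_right _), star_mul, star_star]

theorem hs_sq_le {A B : H →L[ℂ] H} (hA : IsHS A) (hB : IsHS B) :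
    hs A B ^ 2 ≤ hsq A * hsq B := by
  have h : ∀ t : ℝ, 0 ≤ hsq B * (t * t) + 2 * hs A B * t + hsq A := by
    intro t
    have h0 := hsq_nonneg (A + (t : ℂ) • B)
    have hB' := hB.smul t
    rw [← hs_self, hs_add_left hA hB' (hA.add hB'), hs_add_right hA hA hB', hs_add_right hB' hA hB',
      hs_real_smul_left, hs_real_smul_left, hs_real_smul_right, hs_real_smul_right,
      hs_self, hs_self, hs_comm B A] at h0
    linarith
  have := discrim_le_zero h
  rw [discrim] at this
  linarith

theorem hs_le_sqrt_mul_sqrt {A B : H →L[ℂ] H} (hA : IsHS A) (hB : IsHS B) :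
    hs A B ≤ √(hsq A) * √(hsq B) := by
  rw [← Real.sqrt_mul (hsq_nonneg A)]
  exact Real.le_sqrt_of_sq_le (hs_sq_le hA hB)

/-- The orthogonal projection onto the span of finitely many vectors of `traceBasis`. -/
noncomputable def basisProj (F : Finset (traceIndex H)) : H →L[ℂ] H :=
  ∑ i ∈ F, InnerProductSpace.rankOne ℂ (traceBasis H i) (traceBasis H i)

theorem basisProj_apply [DecidableEq (traceIndex H)] (F : Finset (traceIndex H))
    (i : traceIndex H) : basisProj F (traceBasis H i) = if i ∈ F then traceBasis H i else 0 := by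
  have h := orthonormal_iff_ite.1 (traceBasis H).orthonormal
  simp [basisProj, h]

theorem star_basisProj (F : Finset (traceIndex H)) : star (basisProj F) = basisProj F := by
  simp [basisProj, star_sum, ContinuousLinearMap.star_eq_adjoint]

theorem isHS_basisProj (F : Finset (traceIndex H)) : IsHS (basisProj F) := by
  classical
  refine summable_of_ne_finset_zero (s := F) fun i hi => ?_
  simp [basisProj_apply, hi]

theorem norm_basisProj_le (F : Finset (traceIndex H)) : ‖basisProj F‖ ≤ 1 := by
  classical
  have h : basisProj F * basisProj F = basisProj F := by
    have h := orthonormal_iff_ite.1 (traceBasis H).orthonormal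
    ext x
    simp [basisProj, h]
  have h2 := CStarRing.norm_star_mul_self (x := basisProj F)
  rw [star_basisProj, h] at h2
  by_contra! h3
  nlinarith

theorem tendsto_hsq_sub_mul_basisProj {A : H →L[ℂ] H} (hA : IsHS A) :
    Filter.Tendsto (fun F => hsq (A - A * basisProj F)) Filter.atTop (nhds 0) := by
  classical
  have h : ∀ F : Finset (traceIndex H), hsq (A - A * basisProj F) =
      hsq A - ∑ i ∈ F, ‖A (traceBasis H i)‖ ^ 2 := by
    intro F
    rw [eq_sub_iff_add_eq', hsq, hsq, ← Summable.sum_add_tsum_compl (s := F) hA,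
      tsum_subtype ((F : Set (traceIndex H))ᶜ) fun i => ‖A (traceBasis H i)‖ ^ 2]
    congr 1
    refine tsum_congr fun i => ?_
    by_cases hi : i ∈ F <;> simp [basisProj_apply, hi]
  simp_rw [h]
  rw [← sub_self (hsq A)]
  exact tendsto_const_nhds.sub hA.hasSum

end HilbertSchmidt

/-! ### Douglas factorization, polar decomposition and the trace norm. -/

section TraceNorm

open scoped Topology

variable {H : Type u} [NormedAddCommGroup H] [InnerProductSpace ℂ H]

theorem re_inner_le_of_le {A B : H →L[ℂ] H} (h : A ≤ B) (x : H) :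
    (inner ℂ x (A x) : ℂ).re ≤ (inner ℂ x (B x) : ℂ).re := by
  have h1 := ((ContinuousLinearMap.le_def A B).1 h).re_inner_nonneg_right x
  rw [sub_apply, inner_sub_right, map_sub] at h1
  exact sub_nonneg.1 h1

variable [CompleteSpace H]

theorem star_eq_self_of_nonneg {A : H →L[ℂ] H} (h : 0 ≤ A) : star A = A :=
  (IsSelfAdjoint.of_nonneg h).star_eq

theorem star_sqrt (A : H →L[ℂ] H) : star (CFC.sqrt A) = CFC.sqrt A :=
  star_eq_self_of_nonneg (CFC.sqrt_nonneg A)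

theorem norm_sq_eq_re_inner_star_mul (C : H →L[ℂ] H) (x : H) :
    ‖C x‖ ^ 2 = (inner ℂ x ((star C * C) x) : ℂ).re := by
  rw [mul_apply_eq_comp, ContinuousLinearMap.star_eq_adjoint,
    ContinuousLinearMap.adjoint_inner_right]
  exact (inner_self_eq_norm_sq (𝕜 := ℂ) _).symm

theorem norm_apply_le_of_star_mul_le {C D : H →L[ℂ] H} (h : star C * C ≤ star D * D) (x : H) :
    ‖C x‖ ≤ ‖D x‖ := by
  refine le_of_sq_le_sq ?_ (norm_nonneg _)
  rw [norm_sq_eq_re_inner_star_mul, norm_sq_eq_re_inner_star_mul]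
  exact re_inner_le_of_le h x

/-- Douglas' factorization lemma. -/
theorem exists_contraction_mul_eq {C D : H →L[ℂ] H} (h : star C * C ≤ star D * D) :
    ∃ W : H →L[ℂ] H, ‖W‖ ≤ 1 ∧ W * D = C ∧ ∀ x, star D x = 0 → W x = 0 := by
  set K : Submodule ℂ H := (LinearMap.range D.toLinearMap).topologicalClosure with hK
  have hmem : ∀ x, D x ∈ K := fun x =>
    Submodule.le_topologicalClosure _ (LinearMap.mem_range_self D.toLinearMap x)
  have : CompleteSpace K :=
    (Submodule.isClosed_topologicalClosure (LinearMap.range D.toLinearMap)).completeSpace_coe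
  let e : H →ₗ[ℂ] K := D.toLinearMap.codRestrict K hmem
  have he : DenseRange e := by
    intro y
    rw [closure_subtype]
    have hy : (y : H) ∈ closure (LinearMap.range D.toLinearMap : Set H) := y.2
    refine closure_mono ?_ hy
    rintro _ ⟨x, rfl⟩
    exact ⟨e x, ⟨x, rfl⟩, rfl⟩
  have hn : ∀ x, ‖C.toLinearMap x‖ ≤ 1 * ‖e x‖ := fun x => by
    rw [one_mul]
    exact norm_apply_le_of_star_mul_le h x
  -- `D x ↦ C x` is well defined and contractive on the range of `D`; it is extended to the closure
  -- `K` and by zero to `Kᗮ`.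
  refine ⟨(C.toLinearMap.extendOfNorm e).comp K.orthogonalProjectionOnto, ?_, ?_, ?_⟩
  · refine ContinuousLinearMap.opNorm_le_bound _ zero_le_one fun x => ?_
    refine (LinearMap.norm_extendOfNorm_apply_le he 1 hn _).trans ?_
    rw [one_mul, one_mul]
    exact K.norm_orthogonalProjectionOnto_apply_le x
  · ext x
    have h1 : K.orthogonalProjectionOnto (D x) = e x :=
      K.orthogonalProjectionOnto_mem_subspace_eq_self (e x)
    simp only [mul_apply_eq_comp, ContinuousLinearMap.comp_apply, h1]
    exact LinearMap.extendOfNorm_eq he ⟨1, hn⟩ x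
  · intro x hx
    have h1 : K.orthogonalProjectionOnto x = 0 := by
      rw [Submodule.orthogonalProjectionOnto_eq_zero_iff, hK, Submodule.orthogonal_closure,
        Submodule.mem_orthogonal]
      rintro _ ⟨y, rfl⟩
      rw [ContinuousLinearMap.coe_coe, ← ContinuousLinearMap.adjoint_inner_right,
        ← ContinuousLinearMap.star_eq_adjoint, hx, inner_zero_right]
    simp [h1]

theorem eq_of_star_sub_mul_sub_eq_zero {A B : H →L[ℂ] H} (h : star (A - B) * (A - B) = 0) :
    A = B :=
  sub_eq_zero.1 ((CStarRing.star_mul_self_eq_zero_iff _).1 h)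

/-- If `∑ i, Cᵢ† Cᵢ = D† D`, then `Cᵢ = Rᵢ D` with contractions `Rᵢ` that vanish on
`(range D)ᗮ` and such that `∑ i, Rᵢ† Rᵢ` is the projection onto the closed range of `D`. -/
theorem exists_contractions_of_sum_eq {ι : Type*} (s : Finset ι) {C : ι → H →L[ℂ] H}
    {D : H →L[ℂ] H} (h : ∑ i ∈ s, star (C i) * C i = star D * D) :
    ∃ R : ι → H →L[ℂ] H, (∀ i ∈ s, ‖R i‖ ≤ 1 ∧ R i * D = C i ∧ ∀ x, star D x = 0 → R i x = 0) ∧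
      (∑ i ∈ s, star (R i) * R i) * D = D := by
  have h1 : ∀ i ∈ s, ∃ R : H →L[ℂ] H, ‖R‖ ≤ 1 ∧ R * D = C i ∧ ∀ x, star D x = 0 → R x = 0 := by
    intro i hi
    refine exists_contraction_mul_eq ?_
    rw [← h]
    exact Finset.single_le_sum (f := fun i => star (C i) * C i)
      (fun j _ => star_mul_self_nonneg (C j)) hi
  choose! R hR using h1
  refine ⟨R, hR, ?_⟩
  set P := ∑ i ∈ s, star (R i) * R i with hP
  have hPs : star P = P := by simp [hP, star_sum]
  -- `P D - D` maps into the kernel of `D†`, where every `R i`, hence `P`, vanishes. Therefore `(P D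
  -- - D)† (P D - D) = 0`.
  have h2 : star D * (P * D - D) = 0 := by
    rw [mul_sub, ← h, hP, Finset.sum_mul, Finset.mul_sum, sub_eq_zero]
    refine Finset.sum_congr rfl fun i hi => ?_
    rw [← (hR i hi).2.1, star_mul]
    simp only [mul_assoc]
  have h3 : P * (P * D - D) = 0 := by
    rw [hP, Finset.sum_mul]
    refine Finset.sum_eq_zero fun i hi => ?_
    rw [mul_assoc, ← hP]
    have : R i * (P * D - D) = 0 := by
      ext x
      rw [mul_apply_eq_comp, (hR i hi).2.2]
      · rfl
      · rw [← mul_apply_eq_comp, h2]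
        rfl
    rw [this, mul_zero]
  refine eq_of_star_sub_mul_sub_eq_zero ?_
  rw [star_sub, sub_mul, h2, star_mul, hPs, mul_assoc, h3, mul_zero, sub_zero]

/-- Polar decomposition. -/
theorem exists_polar (T : H →L[ℂ] H) :
    ∃ W : H →L[ℂ] H, ‖W‖ ≤ 1 ∧ W * CFC.sqrt (star T * T) = T ∧
      star W * T = CFC.sqrt (star T * T) := by
  set Q := CFC.sqrt (star T * T) with hQ
  have hQQ : star Q * Q = star T * T := by
    rw [star_sqrt]
    exact CFC.sqrt_mul_sqrt_self _ (star_mul_self_nonneg T)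
  -- For this one-element family, `R† R Q = Q` is what turns `R Q = T` into `R† T = Q`.
  obtain ⟨R, hR, hR'⟩ := exists_contractions_of_sum_eq (Finset.univ : Finset Unit)
    (C := fun _ => T) (D := Q) (by simpa using hQQ.symm)
  obtain ⟨h1, h2, -⟩ := hR () (Finset.mem_univ _)
  refine ⟨R (), h1, h2, ?_⟩
  simp only [Finset.univ_unique, Finset.sum_singleton] at hR'
  rw [mul_assoc] at hR'
  change star (R ()) * (R () * Q) = Q at hR'
  rwa [h2] at hR'

theorem re_opTrace_star_mul {A B : H →L[ℂ] H} (hA : IsHS A) (hB : IsHS B) :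
    (opTrace (star A * B)).re = hs A B := by
  have h : ∀ x, (inner ℂ x ((star A * B) x) : ℂ) = inner ℂ (A x) (B x) := fun x => by
    rw [mul_apply_eq_comp, ContinuousLinearMap.star_eq_adjoint,
      ContinuousLinearMap.adjoint_inner_right]
  rw [re_opTrace]
  · simp_rw [h]
    rfl
  · simp_rw [h]
    exact hA.summable_inner hB

theorem re_opTrace_of_isHS_sqrt {T : H →L[ℂ] H} (h0 : 0 ≤ T) (h : IsHS (CFC.sqrt T)) :
    (opTrace T).re = hsq (CFC.sqrt T) := by
  rw [← hs_self, ← re_opTrace_star_mul h h, star_sqrt, CFC.sqrt_mul_sqrt_self T h0]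

/-- The square root of `|ab|` is Hilbert–Schmidt if `a` and `b` are. -/
theorem IsHS.sqrt_abs_mul {a b : H →L[ℂ] H} (ha : IsHS a) (hb : IsHS b) :
    IsHS (CFC.sqrt (CFC.sqrt (Star.star (a * b) * (a * b)))) := by
  obtain ⟨V, -, -, hV⟩ := exists_polar (a * b)
  have h := ((ha.star.mul_right V).summable_re hb)
  refine h.congr fun i => ?_
  rw [norm_sq_eq_re_inner_star_mul, star_sqrt, CFC.sqrt_mul_sqrt_self _ (CFC.sqrt_nonneg _), ← hV]
  simp only [mul_apply_eq_comp, ContinuousLinearMap.star_eq_adjoint,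
    ContinuousLinearMap.adjoint_inner_right, ContinuousLinearMap.adjoint_inner_left]

theorem traceNorm_mul_eq_hsq {a b : H →L[ℂ] H} (ha : IsHS a) (hb : IsHS b) :
    traceNorm (a * b) = hsq (CFC.sqrt (CFC.sqrt (star (a * b) * (a * b)))) :=
  re_opTrace_of_isHS_sqrt (CFC.sqrt_nonneg _) (ha.sqrt_abs_mul hb)

theorem exists_traceNorm_eq_hs {a b : H →L[ℂ] H} (ha : IsHS a) (hb : IsHS b) :
    ∃ V : H →L[ℂ] H, ‖V‖ ≤ 1 ∧ traceNorm (a * b) = hs (star a * V) b := by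
  obtain ⟨V, hV1, -, hV⟩ := exists_polar (a * b)
  refine ⟨V, hV1, ?_⟩
  rw [traceNorm, ← hV, ← re_opTrace_star_mul (ha.star.mul_right V) hb, star_mul, star_star,
    mul_assoc]

/-- Write `a b = V r r` with `r = √|a b|`. The pairing becomes one of `r V† Z` with `r Y`, and
Cauchy–Schwarz applies because `hsq r = ‖a b‖₁`. This is the duality bound that
`exists_traceNorm_eq_hs` attains. -/
theorem hs_mul_le_traceNorm {a b Z Y : H →L[ℂ] H} (ha : IsHS a) (hb : IsHS b) (hZ : ‖Z‖ ≤ 1)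
    (hY : ‖Y‖ ≤ 1) : hs (star a * Z) (b * Y) ≤ traceNorm (a * b) := by
  obtain ⟨V, hV1, hV, -⟩ := exists_polar (a * b)
  set q := CFC.sqrt (star (a * b) * (a * b)) with hq
  set r := CFC.sqrt q with hr
  have hr' : IsHS r := ha.sqrt_abs_mul hb
  have h : hs (star a * Z) (b * Y) = hs (r * (star V * Z)) (r * Y) := by
    rw [hs_mul_left, star_star, ← mul_assoc a, ← hV, hs_mul_left r, ← mul_assoc (star r), star_sqrt,
      CFC.sqrt_mul_sqrt_self q (CFC.sqrt_nonneg _), hs_mul_left (star V), star_star, mul_assoc]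
  have hVZ : ‖star V * Z‖ ≤ 1 :=
    (norm_mul_le _ _).trans (mul_le_one₀ (by rwa [norm_star]) (norm_nonneg _) hZ)
  rw [h, traceNorm_mul_eq_hsq ha hb]
  refine (hs_le_sqrt_mul_sqrt (hr'.mul_right _) (hr'.mul_right _)).trans ?_
  rw [← Real.mul_self_sqrt (hsq_nonneg r)]
  exact mul_le_mul (Real.sqrt_le_sqrt (hsq_mul_right_le hr' hVZ))
    (Real.sqrt_le_sqrt (hsq_mul_right_le hr' hY)) (Real.sqrt_nonneg _) (Real.sqrt_nonneg _)

theorem traceNorm_mul_nonneg {a b : H →L[ℂ] H} (ha : IsHS a) (hb : IsHS b) :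
    0 ≤ traceNorm (a * b) := by
  rw [traceNorm_mul_eq_hsq ha hb]
  exact hsq_nonneg _

theorem traceNorm_mul_le {a b : H →L[ℂ] H} (ha : IsHS a) (hb : IsHS b) :
    traceNorm (a * b) ≤ √(hsq a) * √(hsq b) := by
  obtain ⟨V, hV, h⟩ := exists_traceNorm_eq_hs ha hb
  rw [h, ← hsq_star a]
  refine (hs_le_sqrt_mul_sqrt (ha.star.mul_right V) hb).trans ?_
  exact mul_le_mul_of_nonneg_right (Real.sqrt_le_sqrt (hsq_mul_right_le ha.star hV))
    (Real.sqrt_nonneg _)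

/-- Splitting `1 = T + (1 - T)` inside the trace norm of a product. -/
theorem traceNorm_mul_le_of_le_one {a b T : H →L[ℂ] H} (ha : IsHS a) (hb : IsHS b) (hT0 : 0 ≤ T)
    (hT1 : T ≤ 1) :
    traceNorm (a * b) ≤ √(hsq (CFC.sqrt (1 - T) * star a)) * √(hsq (CFC.sqrt (1 - T) * b)) +
      √(hsq (CFC.sqrt T * star a)) * √(hsq (CFC.sqrt T * b)) := by
  obtain ⟨V, hV, h⟩ := exists_traceNorm_eq_hs ha hb
  have key : ∀ S : H →L[ℂ] H, 0 ≤ S →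
      hs (star a * V) (S * b) ≤ √(hsq (CFC.sqrt S * star a)) * √(hsq (CFC.sqrt S * b)) := by
    intro S hS
    have h1 : hs (star a * V) (S * b) = hs (CFC.sqrt S * star a * V) (CFC.sqrt S * b) := by
      rw [mul_assoc, hs_mul_left (CFC.sqrt S), star_sqrt, ← mul_assoc (CFC.sqrt S),
        CFC.sqrt_mul_sqrt_self S hS]
    rw [h1]
    refine (hs_le_sqrt_mul_sqrt ((ha.star.mul_left _).mul_right V) (hb.mul_left _)).trans ?_
    exact mul_le_mul_of_nonneg_right
      (Real.sqrt_le_sqrt (hsq_mul_right_le (ha.star.mul_left _) hV)) (Real.sqrt_nonneg _)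
  have h2 : b = (1 - T) * b + T * b := by noncomm_ring
  rw [h]
  conv_lhs => rw [h2]
  rw [hs_add_right (ha.star.mul_right V) (hb.mul_left _) (hb.mul_left _)]
  exact add_le_add (key _ (sub_nonneg.2 hT1)) (key _ hT0)

/-- The Hilbert–Schmidt inner product of positive operators is nonnegative. -/
theorem hs_nonneg {Q N : H →L[ℂ] H} (hQ : 0 ≤ Q) (hN : 0 ≤ N) (hQ' : IsHS Q) (hN' : IsHS N) :
    0 ≤ hs Q N := by
  -- `√Q` need not be Hilbert–Schmidt when `Q` is. So `Q` is compressed by a finite-rank projection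
  -- `P`, for which `√Q P` is Hilbert–Schmidt and the pairing is a square; the error vanishes as `P`
  -- increases.
  have hlow : ∀ F : Finset (traceIndex H),
      -(2 * (√(hsq (Q - Q * basisProj F)) * √(hsq N))) ≤ hs Q N := by
    intro F
    set P := basisProj F with hP
    have hPs : star P = P := star_basisProj F
    have hQs := star_eq_self_of_nonneg hQ
    have h1 : 0 ≤ hs (P * Q * P) N := by
      set C := CFC.sqrt Q * P
      set ν := CFC.sqrt N
      have hC : IsHS C := (isHS_basisProj F).mul_left _
      have e1 : P * Q * P = star C * C := by
        rw [star_mul, star_sqrt, hPs, mul_assoc P (CFC.sqrt Q), ← mul_assoc (CFC.sqrt Q),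
          CFC.sqrt_mul_sqrt_self Q hQ, mul_assoc]
      have e2 : C * N = C * ν * star ν := by
        rw [star_sqrt, mul_assoc C, CFC.sqrt_mul_sqrt_self N hN]
      rw [e1, hs_mul_left, star_star, e2, ← hs_mul_right hC (hC.mul_right _), hs_self]
      exact hsq_nonneg _
    have h2 : Q = P * Q * P + ((Q - Q * P) + (Q - P * Q) * P) := by noncomm_ring
    have i1 : IsHS (Q - Q * P) := hQ'.sub (hQ'.mul_right P)
    have i2 : IsHS (Q - P * Q) := hQ'.sub (hQ'.mul_left P)
    have h3 : hs Q N = hs (P * Q * P) N + (hs (Q - Q * P) N + hs (Q - P * Q) (N * P)) := by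
      conv_lhs => rw [h2]
      rw [hs_add_left ((hQ'.mul_left P).mul_right P) (i1.add (i2.mul_right P)) hN',
        hs_add_left i1 (i2.mul_right P) hN', hs_mul_right i2 hN', hPs]
    have hle : ∀ {A B : H →L[ℂ] H}, IsHS A → IsHS B → -(√(hsq A) * √(hsq B)) ≤ hs A B := by
      intro A B hA hB
      rw [← Real.sqrt_mul (hsq_nonneg A)]
      exact (abs_le.1 (Real.abs_le_sqrt (hs_sq_le hA hB))).1
    have h4 := hle i1 hN'
    have h5 := hle i2 (hN'.mul_right P)
    have h6 : hsq (Q - P * Q) = hsq (Q - Q * P) := by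
      rw [← hsq_star, star_sub, star_mul, hQs, hPs]
    have h7 : √(hsq (Q - P * Q)) * √(hsq (N * P)) ≤ √(hsq (Q - Q * P)) * √(hsq N) := by
      rw [h6]
      exact mul_le_mul_of_nonneg_left
        (Real.sqrt_le_sqrt (hsq_mul_right_le hN' (norm_basisProj_le F))) (Real.sqrt_nonneg _)
    linarith
  have ht := (tendsto_hsq_sub_mul_basisProj hQ').sqrt
  have ht2 := ((ht.mul_const (√(hsq N))).const_mul 2).neg
  simp only [Real.sqrt_zero, zero_mul, mul_zero, neg_zero] at ht2
  exact le_of_tendsto' ht2 hlow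

end TraceNorm

/-! ### The pretty-good measurement and its error bound. -/

section PrettyGood

variable {H : Type u} [NormedAddCommGroup H] [InnerProductSpace ℂ H] [CompleteSpace H]

/-- The off-diagonal block `x s y` of the square root of a `2 × 2` block operator is controlled
by the off-diagonal block `x s² y` of the operator itself. -/
theorem exists_two_mul_hsq_le {x y s : H →L[ℂ] H} (hx : star x = x) (hy : star y = y) (hs0 : 0 ≤ s)
    (hs1 : IsHS s) (h : (x * x + y * y) * s = s) :
    ∃ W : H →L[ℂ] H, ‖W‖ ≤ 1 ∧ 2 * hsq (x * s * y) ≤ hs (s * x * W) (s * y) := by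
  have hss : star s = s := star_eq_self_of_nonneg hs0
  obtain ⟨o, ho⟩ : ∃ o, o = x * s * y := ⟨_, rfl⟩
  obtain ⟨Q, W, hQ0, hW1, hW, hWo⟩ : ∃ Q W : H →L[ℂ] H, 0 ≤ Q ∧ ‖W‖ ≤ 1 ∧ W * Q = o ∧
      star W * o = Q := by
    obtain ⟨W, h1, h2, h3⟩ := exists_polar o
    exact ⟨_, W, CFC.sqrt_nonneg _, h1, h2, h3⟩
  have hQs : star Q = Q := star_eq_self_of_nonneg hQ0
  have ho' : IsHS o := ho ▸ (hs1.mul_left x).mul_right y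
  have hQ' : IsHS Q := hWo ▸ ho'.mul_left _
  have hoW : y * s * x * W = Q := by
    have := congrArg star hWo
    rw [hQs] at this
    rw [← this]
    simp only [ho, star_mul, star_star, hx, hy, hss, mul_assoc]
  have hWo2 : star W * (x * s * y) = Q := ho ▸ hWo
  refine ⟨W, hW1, ?_⟩
  rw [← ho]
  have i1 : IsHS (star W * (x * s * x * W)) :=
    (((hs1.mul_left x).mul_right x).mul_right W).mul_left _
  have i2 : IsHS (y * s * y) := (hs1.mul_left y).mul_right y
  -- Conjugating `s ≥ 0` by `x W - y`, with `W` the polar factor of `o = x s y`, turns both cross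
  -- terms into `Q = |o|`. Pairing the result with `Q ≥ 0` bounds `2 ‖o‖₂²` by the two diagonal
  -- contributions.
  have hN2 : star (x * W - y) * s * (x * W - y) =
      star W * (x * s * x * W) + y * s * y - Q - Q := by
    calc star (x * W - y) * s * (x * W - y)
        = star W * (x * s * x * W) + y * s * y - star W * (x * s * y) - y * s * x * W := by
          rw [star_sub, star_mul, hx, hy]
          noncomm_ring
      _ = _ := by rw [hWo2, hoW]
  have hpos := hs_nonneg hQ0 (star_left_conjugate_nonneg hs0 (x * W - y)) hQ'
    ((hs1.mul_left _).mul_right _)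
  rw [hN2, hs_sub_right hQ' ((i1.add i2).sub hQ') hQ', hs_sub_right hQ' (i1.add i2) hQ',
    hs_add_right hQ' i1 i2, hs_self] at hpos
  have hQo : hsq Q = hsq o := by
    rw [← hs_self Q, ← hs_self o]
    conv_rhs => rw [← hW]
    rw [hs_mul_left, hW, hWo]
  -- As `x² + y²` fixes `s`, this splits the off-diagonal block of `s²` into exactly those two
  -- diagonal contributions.
  have e1 : s * y = x * o + y * (y * s * y) := by
    rw [ho]
    conv_lhs => rw [← h]
    noncomm_ring
  have e2 : hs (s * x * W) (s * y) =
      hs Q (star W * (x * s * x * W)) + hs Q (y * s * y) := by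
    have j : IsHS (s * x * W) := (hs1.mul_right x).mul_right W
    rw [e1, hs_add_right j (ho'.mul_left x) (i2.mul_left y)]
    congr 1
    · have e3 := hs_mul_left x (s * x * W) o
      rw [hx] at e3
      rw [← e3, hs_comm Q, hs_mul_left (star W), star_star, hW]
      simp only [mul_assoc]
    · have e3 := hs_mul_left y (s * x * W) (y * s * y)
      rw [hy] at e3
      rw [← e3, ← hoW]
      simp only [mul_assoc]
  rw [e2]
  linarith

theorem hs_mul_self_eq_hsq {X D : H →L[ℂ] H} (hD : 0 ≤ D) :
    hs X (D * X) = hsq (CFC.sqrt D * X) := by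
  rw [← hs_self, hs_mul_left, star_sqrt, ← mul_assoc, CFC.sqrt_mul_sqrt_self D hD]

theorem hs_mul_self_mono {X T T' : H →L[ℂ] H} (hX : IsHS X) (h : T ≤ T') :
    hs X (T * X) ≤ hs X (T' * X) := by
  rw [← sub_nonneg, ← hs_sub_right hX (hX.mul_left _) (hX.mul_left _), ← sub_mul,
    hs_mul_self_eq_hsq (sub_nonneg.2 h)]
  exact hsq_nonneg _

theorem re_opTrace_mul_star_mul {T X : H →L[ℂ] H} (hX : IsHS X) :
    (opTrace (T * (X * star X))).re = hs X (T * X) := by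
  have h : T * (X * star X) = star (star X * star T) * star X := by
    rw [star_mul, star_star, star_star, mul_assoc]
  rw [h, re_opTrace_star_mul (hX.star.mul_right _) hX.star, ← star_mul,
    hs_star_star (hX.mul_left T) hX, hs_comm]

/-- On each basis vector, `‖√(∑ A_j) e‖² = ∑ ‖√A_j e‖²`. -/
theorem isHS_sqrt_sum {M : ℕ} {A : Fin M → H →L[ℂ] H} (hA : ∀ m, 0 ≤ A m)
    (h : ∀ m, IsHS (CFC.sqrt (A m))) : IsHS (CFC.sqrt (∑ j, A j)) := by
  refine (summable_sum (s := Finset.univ) fun j _ => h j).congr fun i => ?_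
  have key : ∀ {B : H →L[ℂ] H}, 0 ≤ B → ∀ x, ‖CFC.sqrt B x‖ ^ 2 = (inner ℂ x (B x) : ℂ).re := by
    intro B hB x
    rw [norm_sq_eq_re_inner_star_mul, star_sqrt, CFC.sqrt_mul_sqrt_self B hB]
  rw [key (Finset.sum_nonneg fun m _ => hA m), sum_apply, inner_sum, Complex.re_sum]
  exact Finset.sum_congr rfl fun j _ => key (hA j) _

namespace IsPrettyGoodTuple

variable {M : ℕ} {A E : Fin M → H →L[ℂ] H}

theorem sqrt_sum_apply_eq_zero (hA : ∀ m, 0 ≤ A m) {x : H}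
    (h : CFC.sqrt (∑ j, A j) x = 0) : (∑ j, A j) x = 0 := by
  rw [← CFC.sqrt_mul_sqrt_self (∑ j, A j) (Finset.sum_nonneg fun m _ => hA m),
    mul_apply_eq_comp, h, map_zero]

theorem sum_mul_eq_zero (hE : IsPrettyGoodTuple A E) (hA : ∀ m, 0 ≤ A m) {T : H →L[ℂ] H}
    (h : CFC.sqrt (∑ j, A j) * T = 0) : (∑ j, E j) * T = 0 := by
  rw [Finset.sum_mul]
  refine Finset.sum_eq_zero fun m _ => ?_
  ext x
  rw [mul_apply_eq_comp, (hE m).2.1 _ (sqrt_sum_apply_eq_zero hA _)]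
  · rfl
  · rw [← mul_apply_eq_comp, h]
    rfl

/-- Let `P = ∑ E_j`. From `√S P √S = S`, the operator `√S` annihilates `P √S - √S`; since every
`E_j` vanishes on `ker S`, so does `P`. -/
theorem sum_mul_sqrt (hE : IsPrettyGoodTuple A E) (hA : ∀ m, 0 ≤ A m) :
    (∑ j, E j) * CFC.sqrt (∑ j, A j) = CFC.sqrt (∑ j, A j) := by
  have hS : 0 ≤ ∑ j, A j := Finset.sum_nonneg fun m _ => hA m
  have hP : star (∑ j, E j) = ∑ j, E j :=
    star_eq_self_of_nonneg (Finset.sum_nonneg fun m _ => (hE m).1)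
  have h1 : CFC.sqrt (∑ j, A j) * ((∑ j, E j) * CFC.sqrt (∑ j, A j) - CFC.sqrt (∑ j, A j)) = 0 := by
    rw [mul_sub, CFC.sqrt_mul_sqrt_self _ hS, ← mul_assoc, Finset.mul_sum, Finset.sum_mul,
      sub_eq_zero]
    exact Finset.sum_congr rfl fun m _ => (hE m).2.2
  refine eq_of_star_sub_mul_sub_eq_zero ?_
  rw [star_sub, star_mul, hP, star_sqrt, sub_mul, h1, mul_assoc, hE.sum_mul_eq_zero hA h1,
    mul_zero, sub_zero]

/-- `1 - P` is annihilated by `√S`, hence by `P`, so it is a projection. -/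
theorem sum_le_one (hE : IsPrettyGoodTuple A E) (hA : ∀ m, 0 ≤ A m) : ∑ j, E j ≤ 1 := by
  have hP : star (∑ j, E j) = ∑ j, E j :=
    star_eq_self_of_nonneg (Finset.sum_nonneg fun m _ => (hE m).1)
  have h1 : CFC.sqrt (∑ j, A j) * (1 - ∑ j, E j) = 0 := by
    have h2 := congrArg star (hE.sum_mul_sqrt hA)
    rw [star_mul, star_sqrt, hP] at h2
    rw [mul_sub, mul_one, h2, sub_self]
  have h3 := hE.sum_mul_eq_zero hA h1
  have h4 : 1 - ∑ j, E j = star (1 - ∑ j, E j) * (1 - ∑ j, E j) := by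
    rw [star_sub, star_one, hP, sub_mul, h3, one_mul, sub_zero]
  rw [← sub_nonneg, h4]
  exact star_mul_self_nonneg _

end IsPrettyGoodTuple

/-- Douglas' lemma supplies `R_m` in the role of `√A_m S^{-1/2}` without an unbounded inverse; then
`E_m = R_m† R_m`. -/
theorem exists_isPrettyGoodTuple {M : ℕ} {A : Fin M → H →L[ℂ] H} (hA : ∀ m, 0 ≤ A m) :
    ∃ E : Fin M → H →L[ℂ] H, IsPrettyGoodTuple A E := by
  have hS : 0 ≤ ∑ j, A j := Finset.sum_nonneg fun m _ => hA m
  have h : ∀ m, ∃ W : H →L[ℂ] H, ‖W‖ ≤ 1 ∧ W * CFC.sqrt (∑ j, A j) = CFC.sqrt (A m) ∧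
      ∀ x, star (CFC.sqrt (∑ j, A j)) x = 0 → W x = 0 := by
    intro m
    refine exists_contraction_mul_eq ?_
    rw [star_sqrt, star_sqrt, CFC.sqrt_mul_sqrt_self _ (hA m), CFC.sqrt_mul_sqrt_self _ hS]
    exact Finset.single_le_sum (fun j _ => hA j) (Finset.mem_univ m)
  choose R _ hR hR0 using h
  refine ⟨fun m => star (R m) * R m, fun m => ⟨star_mul_self_nonneg _, fun x hx => ?_, ?_⟩⟩
  · rw [mul_apply_eq_comp, hR0 m x, map_zero]
    rw [star_sqrt, ← norm_eq_zero, ← sq_eq_zero_iff, norm_sq_eq_re_inner_star_mul, star_sqrt,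
      CFC.sqrt_mul_sqrt_self _ hS, hx, inner_zero_right, Complex.zero_re]
  · have h1 := congrArg star (hR m)
    rw [star_mul, star_sqrt, star_sqrt] at h1
    rw [← mul_assoc, h1, mul_assoc, hR m, CFC.sqrt_mul_sqrt_self _ (hA m)]

/-- The whole remainder `1 - ∑ E_j` is assigned to the outcome `m₀`. -/
theorem exists_isPrettyGoodMeasurement {M : ℕ} {A : Fin M → H →L[ℂ] H} (hA : ∀ m, 0 ≤ A m)
    (m₀ : Fin M) : ∃ Λ : Fin M → H →L[ℂ] H, IsPrettyGoodMeasurement A Λ := by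
  obtain ⟨E, hE⟩ := exists_isPrettyGoodTuple hA
  have h0 : ∀ m, 0 ≤ (if m = m₀ then 1 - ∑ j, E j else 0 : H →L[ℂ] H) := by
    intro m
    split_ifs
    · exact sub_nonneg.2 (hE.sum_le_one hA)
    · exact le_rfl
  refine ⟨fun m => E m + if m = m₀ then 1 - ∑ j, E j else 0,
    ⟨fun m => add_nonneg (hE m).1 (h0 m), ?_⟩, E, hE, fun m => le_add_of_nonneg_right (h0 m)⟩
  rw [Finset.sum_add_distrib, Finset.sum_ite_eq' Finset.univ m₀]
  simp

/-- The `m`-th contribution to the error probability of a pretty-good measurement. -/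
theorem IsPrettyGoodMeasurement.re_opTrace_le {M : ℕ} {A Λ : Fin M → H →L[ℂ] H}
    (hΛ : IsPrettyGoodMeasurement A Λ) (hA : ∀ m, 0 ≤ A m) (hA' : ∀ m, IsHS (CFC.sqrt (A m)))
    (m : Fin M) :
    2 * (opTrace ((1 - Λ m) * A m)).re ≤
      ∑ j ∈ Finset.univ.erase m, traceNorm (CFC.sqrt (A m) * CFC.sqrt (A j)) := by
  obtain ⟨-, E, hE, hEΛ⟩ := hΛ
  set s := CFC.sqrt (∑ j, A j) with hs_def
  have hs0 : 0 ≤ s := CFC.sqrt_nonneg _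
  have hss : star s = s := star_sqrt _
  have hs1 : IsHS s := isHS_sqrt_sum hA hA'
  set E' := ∑ j ∈ Finset.univ.erase m, E j with hE'
  have hE'0 : 0 ≤ E' := Finset.sum_nonneg fun j _ => (hE j).1
  have hsum : E m + E' = ∑ j, E j := Finset.add_sum_erase _ _ (Finset.mem_univ m)
  set x := CFC.sqrt (E m) with hx
  set y := CFC.sqrt E' with hy
  have hxs : star x = x := star_sqrt _
  have hys : star y = y := star_sqrt _
  have hxx : x * x = E m := CFC.sqrt_mul_sqrt_self _ (hE m).1
  have hyy : y * y = E' := CFC.sqrt_mul_sqrt_self _ hE'0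
  have hP : (x * x + y * y) * s = s := by
    rw [hxx, hyy, hsum]
    exact hE.sum_mul_sqrt hA
  have hsx : IsHS (s * x) := hs1.mul_right x
  -- `Λ m` may be lowered to `E m`, and on the range of `s` the operator `1 - E m` acts as `E'`.
  have step1 : (opTrace ((1 - Λ m) * A m)).re ≤ hsq (x * s * y) := by
    have e : A m = s * x * star (s * x) := by
      rw [star_mul, hss, hxs, ← (hE m).2.2, ← hxx]
      simp only [mul_assoc, hs_def]
    rw [e, re_opTrace_mul_star_mul hsx]
    refine (hs_mul_self_mono hsx (sub_le_sub_left (hEΛ m) 1)).trans_eq ?_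
    have e2 : (1 - E m) * (s * x) = E' * (s * x) := by
      rw [hxx, hyy] at hP
      calc (1 - E m) * (s * x) = s * x - E m * s * x := by noncomm_ring
        _ = (E m + E') * s * x - E m * s * x := by rw [hP]
        _ = E' * (s * x) := by noncomm_ring
    rw [e2, hs_mul_self_eq_hsq hE'0, ← hsq_star, star_mul, star_mul, hss, hxs, star_sqrt]
  obtain ⟨W, hW1, hW⟩ := exists_two_mul_hsq_le hxs hys hs0 hs1 hP
  -- `s E_j s = A_j` says that `√E_j s` and `√A_j` have the same absolute square.
  have hfac : ∀ j, ∃ U : H →L[ℂ] H, ‖U‖ ≤ 1 ∧ s * CFC.sqrt (E j) = CFC.sqrt (A j) * U := by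
    intro j
    obtain ⟨U, hU1, hU, -⟩ := exists_contraction_mul_eq (C := CFC.sqrt (E j) * s)
      (D := CFC.sqrt (A j)) (by
        refine le_of_eq ?_
        rw [star_mul, hss, star_sqrt, star_sqrt, CFC.sqrt_mul_sqrt_self _ (hA j), ← (hE j).2.2,
          mul_assoc, ← mul_assoc (CFC.sqrt (E j)), CFC.sqrt_mul_sqrt_self _ (hE j).1, mul_assoc])
    refine ⟨star U, by rwa [norm_star], ?_⟩
    have := congrArg star hU
    rw [star_mul, star_mul, hss, star_sqrt, star_sqrt] at this
    exact this.symm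
  choose U hU1 hU using hfac
  -- Since `y² = ∑_{j≠m} E_j`, one gets `y = ∑ √E_j R_j` with contractions, which splits `s y` over
  -- the wrong outcomes.
  obtain ⟨R, hR, hR'⟩ := exists_contractions_of_sum_eq (Finset.univ.erase m)
    (C := fun j => CFC.sqrt (E j)) (D := y) (by
      rw [hys, hyy]
      exact Finset.sum_congr rfl fun j _ => by
        rw [star_sqrt, CFC.sqrt_mul_sqrt_self _ (hE j).1])
  have hy2 : s * y = ∑ j ∈ Finset.univ.erase m, CFC.sqrt (A j) * (U j * R j) := by
    have h1 := congrArg star hR'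
    rw [star_mul, hys, star_sum, Finset.mul_sum] at h1
    rw [← h1, Finset.mul_sum]
    refine Finset.sum_congr rfl fun j hj => ?_
    have h2 := congrArg star (hR j hj).2.1
    rw [star_mul, hys, star_sqrt] at h2
    rw [star_mul, star_star, ← mul_assoc y, h2, ← mul_assoc s, hU, mul_assoc]
  have hmul : ∀ {Z Y : H →L[ℂ] H}, ‖Z‖ ≤ 1 → ‖Y‖ ≤ 1 → ‖Z * Y‖ ≤ 1 := fun hZ hY =>
    (norm_mul_le _ _).trans (mul_le_one₀ hZ (norm_nonneg _) hY)
  calc 2 * (opTrace ((1 - Λ m) * A m)).re ≤ 2 * hsq (x * s * y) := by linarith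
    _ ≤ hs (s * x * W) (s * y) := hW
    _ = ∑ j ∈ Finset.univ.erase m,
        hs (star (CFC.sqrt (A m)) * (U m * W)) (CFC.sqrt (A j) * (U j * R j)) := by
      rw [hy2, hs_sum_right _ (hsx.mul_right W) fun j _ => (hA' j).mul_right _, star_sqrt, hU m,
        mul_assoc]
    _ ≤ _ := Finset.sum_le_sum fun j hj =>
      hs_mul_le_traceNorm (hA' m) (hA' j) (hmul (hU1 m) hW1) (hmul (hU1 j) (hR j hj).1)

end PrettyGood

/-! ### Tensor products and tensor powers of operators. -/

section Tensor

open scoped ENNReal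
open UniformSpace

variable {H K : Type u} [NormedAddCommGroup H] [InnerProductSpace ℂ H] [NormedAddCommGroup K]
  [InnerProductSpace ℂ K]

theorem opTensor_coe (A : H →L[ℂ] H) (B : K →L[ℂ] K) (t : H ⊗[ℂ] K) :
    opTensor A B (t : HilbertTensor H K) = (TensorProduct.mapL A B t : H ⊗[ℂ] K) :=
  ContinuousLinearMap.completion_apply_coe _ _

theorem opTensor_mul (A A' : H →L[ℂ] H) (B B' : K →L[ℂ] K) :
    opTensor (A * A') (B * B') = opTensor A B * opTensor A' B' := by
  ext z
  induction z using Completion.induction_on with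
  | hp => exact isClosed_eq (map_continuous _) (map_continuous _)
  | ih t => rw [mul_apply_eq_comp, opTensor_coe, opTensor_coe, opTensor_coe, TensorProduct.mapL_mul,
      mul_apply_eq_comp]

theorem star_opTensor [CompleteSpace H] [CompleteSpace K] (A : H →L[ℂ] H) (B : K →L[ℂ] K) :
    star (opTensor A B) = opTensor (star A) (star B) := by
  symm
  rw [ContinuousLinearMap.star_eq_adjoint, ContinuousLinearMap.star_eq_adjoint,
    ContinuousLinearMap.star_eq_adjoint, ContinuousLinearMap.eq_adjoint_iff]
  intro z w
  induction z, w using Completion.induction_on₂ with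
  | hp => exact isClosed_eq (by fun_prop) (by fun_prop)
  | ih s t =>
    rw [opTensor_coe, opTensor_coe, Completion.inner_coe, Completion.inner_coe]
    induction s using TensorProduct.induction_on with
    | zero => simp
    | add s s' h h' => rw [map_add, inner_add_left, inner_add_left, h, h']
    | tmul x y =>
      induction t using TensorProduct.induction_on with
      | zero => simp
      | add t t' h h' => rw [map_add, inner_add_right, inner_add_right, h, h']
      | tmul x' y' =>
        rw [TensorProduct.mapL_tmul, TensorProduct.mapL_tmul, TensorProduct.inner_tmul,
          TensorProduct.inner_tmul, ContinuousLinearMap.adjoint_inner_left,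
          ContinuousLinearMap.adjoint_inner_left]

theorem HilbertBasis.orthonormal_tmul_coe {ι κ : Type*} (b : HilbertBasis ι ℂ H)
    (c : HilbertBasis κ ℂ K) : Orthonormal ℂ
      fun i : ι × κ => ((b i.1 ⊗ₜ[ℂ] c i.2 : H ⊗[ℂ] K) : HilbertTensor H K) :=
  (b.orthonormal.tmul c.orthonormal).comp_linearIsometry (Completion.toComplₗᵢ (𝕜 := ℂ))

/-- The product Hilbert basis of a Hilbert tensor product. -/
noncomputable def HilbertBasis.tensor {ι κ : Type*} (b : HilbertBasis ι ℂ H) (c : HilbertBasis κ ℂ K) :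
    HilbertBasis (ι × κ) ℂ (HilbertTensor H K) :=
  HilbertBasis.mkOfOrthogonalEqBot (b.orthonormal_tmul_coe c)
    (by
      rw [eq_bot_iff]
      intro z hz
      rw [Submodule.mem_orthogonal'] at hz
      have hz' : ∀ i j, inner ℂ z ((b i ⊗ₜ[ℂ] c j : H ⊗[ℂ] K) : HilbertTensor H K) = 0 :=
        fun i j => hz _ (Submodule.subset_span ⟨(i, j), rfl⟩)
      -- `φ = ⟪z, ·⟫` vanishes on products of basis vectors. Density in each factor, then linearity,
      -- then density in the completion give `z = 0`.
      let φ : H ⊗[ℂ] K →L[ℂ] ℂ := (innerSL ℂ z).comp Completion.toComplL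
      have hb : Dense (Submodule.span ℂ (Set.range b) : Set H) :=
        Submodule.dense_iff_topologicalClosure_eq_top.2 b.dense_span
      have hc : Dense (Submodule.span ℂ (Set.range c) : Set K) :=
        Submodule.dense_iff_topologicalClosure_eq_top.2 c.dense_span
      have h1 : ∀ j x, φ (x ⊗ₜ c j) = 0 := by
        intro j
        have h : φ.comp ((TensorProduct.mkL ℂ H K).flip (c j)) = 0 := by
          refine ContinuousLinearMap.ext_on hb ?_
          rintro _ ⟨i, rfl⟩
          exact hz' i j
        exact fun x => DFunLike.congr_fun h x
      have h2 : ∀ x y, φ (x ⊗ₜ y) = 0 := by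
        intro x
        have h : φ.comp (TensorProduct.mkL ℂ H K x) = 0 := by
          refine ContinuousLinearMap.ext_on hc ?_
          rintro _ ⟨j, rfl⟩
          exact h1 j x
        exact fun y => DFunLike.congr_fun h y
      have h3 : ∀ t : H ⊗[ℂ] K, φ t = 0 := by
        intro t
        induction t using TensorProduct.induction_on with
        | zero => exact map_zero _
        | add s t hs ht => rw [map_add, hs, ht, add_zero]
        | tmul x y => exact h2 x y
      have h4 : ∀ w : HilbertTensor H K, inner ℂ z w = 0 := by
        intro w
        induction w using Completion.induction_on with
        | hp => exact isClosed_eq (by fun_prop) (by fun_prop)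
        | ih t => exact h3 t
      exact inner_self_eq_zero.1 (h4 z))

theorem HilbertBasis.tensor_apply {ι κ : Type*} (b : HilbertBasis ι ℂ H) (c : HilbertBasis κ ℂ K)
    (i : ι) (j : κ) :
    b.tensor c (i, j) = ((b i ⊗ₜ[ℂ] c j : H ⊗[ℂ] K) : HilbertTensor H K) :=
  congrFun (HilbertBasis.coe_mkOfOrthogonalEqBot (b.orthonormal_tmul_coe c) _) (i, j)

theorem hsENorm_opTensor [CompleteSpace H] [CompleteSpace K] {ι κ : Type*}
    (b : HilbertBasis ι ℂ H) (c : HilbertBasis κ ℂ K) (A : H →L[ℂ] H) (B : K →L[ℂ] K) :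
    hsENorm (b.tensor c) (opTensor A B) = hsENorm b A * hsENorm c B := by
  unfold hsENorm
  rw [ENNReal.tsum_prod (f := fun (i : ι) (j : κ) => ‖opTensor A B (b.tensor c (i, j))‖ₑ ^ 2),
    ← ENNReal.tsum_mul_right]
  refine tsum_congr fun i => ?_
  rw [← ENNReal.tsum_mul_left]
  refine tsum_congr fun j => ?_
  rw [HilbertBasis.tensor_apply, opTensor_coe, TensorProduct.mapL_tmul, ← mul_pow,
    ← TensorProduct.enorm_tmul (𝕜 := ℂ), ← ofReal_norm, ← ofReal_norm, Completion.norm_coe]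

theorem opPow_mul (A B : H →L[ℂ] H) (n : ℕ) : opPow (A * B) n = opPow A n * opPow B n := by
  induction n with
  | zero => exact (one_mul _).symm
  | succ n ih =>
    change opTensor (A * B) (opPow (A * B) n) = _
    rw [ih]
    exact opTensor_mul _ _ _ _

variable [CompleteSpace H]

theorem star_opPow (A : H →L[ℂ] H) (n : ℕ) : star (opPow A n) = opPow (star A) n := by
  induction n with
  | zero => exact star_one _
  | succ n ih =>
    change _ = opTensor (star A) (opPow (star A) n)
    rw [← ih]
    exact star_opTensor _ _

theorem opPow_nonneg {A : H →L[ℂ] H} (hA : 0 ≤ A) (n : ℕ) : 0 ≤ opPow A n := by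
  rw [← CFC.sqrt_mul_sqrt_self A hA, opPow_mul]
  nth_rw 1 [← star_sqrt A]
  rw [← star_opPow]
  exact star_mul_self_nonneg _

theorem sqrt_opPow {A : H →L[ℂ] H} (hA : 0 ≤ A) (n : ℕ) :
    CFC.sqrt (opPow A n) = opPow (CFC.sqrt A) n := by
  refine CFC.sqrt_unique ?_ (opPow_nonneg (CFC.sqrt_nonneg A) n)
  rw [← opPow_mul, CFC.sqrt_mul_sqrt_self A hA]

/-- The basis chosen for `H^{⊗ n}` is unrelated to the product basis; basis independence bridges the
two. -/
theorem hsENorm_opPow (A : H →L[ℂ] H) (n : ℕ) :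
    hsENorm (traceBasis (tensorPow H n).carrier) (opPow A n) = hsENorm (traceBasis H) A ^ n := by
  induction n with
  | zero =>
    let b : HilbertBasis PUnit.{u + 1} ℂ (tensorPow H 0).carrier :=
      (EuclideanSpace.basisFun PUnit.{u + 1} ℂ).toHilbertBasis
    rw [hsENorm_basis_indep _ b, hsENorm, pow_zero, tsum_fintype, Fintype.sum_unique]
    have h : ‖opPow A 0 (b default)‖ = 1 := b.orthonormal.1 default
    rw [← ofReal_norm, h]
    simp
  | succ n ih =>
    have h := hsENorm_opTensor (traceBasis H) (traceBasis (tensorPow H n).carrier) A (opPow A n)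
    rw [ih, ← pow_succ'] at h
    rw [← h]
    exact hsENorm_basis_indep (H := HilbertTensor H (tensorPow H n).carrier) _ _ _

theorem IsHS.opPow {A : H →L[ℂ] H} (hA : IsHS A) (n : ℕ) : IsHS (opPow A n) := by
  rw [isHS_iff, hsENorm_opPow]
  exact ENNReal.pow_ne_top ((isHS_iff A).1 hA)

theorem hsq_opPow (A : H →L[ℂ] H) (n : ℕ) : hsq (opPow A n) = hsq A ^ n := by
  rw [hsq_eq_toReal, hsENorm_opPow, ENNReal.toReal_pow, ← hsq_eq_toReal]

/-- With `P = |a b|²`, both sides are squared Hilbert–Schmidt norms of fourth roots, of `P^{⊗ n}`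
and of `P`, and `hsq` is multiplicative. -/
theorem traceNorm_opPow_mul {a b : H →L[ℂ] H} (ha : IsHS a) (hb : IsHS b) (n : ℕ) :
    traceNorm (opPow a n * opPow b n) = traceNorm (a * b) ^ n := by
  obtain ⟨P, hP⟩ : ∃ P, P = star (a * b) * (a * b) := ⟨_, rfl⟩
  have hP0 : 0 ≤ P := hP ▸ star_mul_self_nonneg (a * b)
  have hq : 0 ≤ CFC.sqrt P := CFC.sqrt_nonneg P
  have h1 : IsHS (CFC.sqrt (CFC.sqrt P)) := hP ▸ ha.sqrt_abs_mul hb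
  have h2 : CFC.sqrt (opPow (CFC.sqrt P) n) = opPow (CFC.sqrt (CFC.sqrt P)) n := sqrt_opPow hq n
  have h3 : IsHS (CFC.sqrt (opPow (CFC.sqrt P) n)) := h2 ▸ h1.opPow n
  rw [← opPow_mul, traceNorm, traceNorm, star_opPow, ← opPow_mul, ← hP, sqrt_opPow hP0,
    re_opTrace_of_isHS_sqrt (opPow_nonneg hq n) h3, h2, hsq_opPow, re_opTrace_of_isHS_sqrt hq h1]

theorem IsState.isHS_sqrt {ρ : H →L[ℂ] H} (h : IsState ρ) : IsHS (CFC.sqrt ρ) := by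
  have h1 : Summable fun i => (inner ℂ (traceBasis H i) (ρ (traceBasis H i)) : ℂ) := by
    -- A divergent sum has the default value `0`, which contradicts trace one.
    by_contra hs
    have h2 : opTrace ρ = 0 := tsum_eq_zero_of_not_summable hs
    exact zero_ne_one (h2.symm.trans h.2)
  refine (Complex.reCLM.summable h1).congr fun i => ?_
  rw [norm_sq_eq_re_inner_star_mul, star_sqrt, CFC.sqrt_mul_sqrt_self ρ h.1]
  rfl

theorem IsState.hsq_sqrt {ρ : H →L[ℂ] H} (h : IsState ρ) : hsq (CFC.sqrt ρ) = 1 := by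
  rw [← re_opTrace_of_isHS_sqrt h.1 h.isHS_sqrt, h.2, Complex.one_re]

end Tensor

/-! ### Error probabilities of an ensemble. -/

section Ensemble

variable {H : Type u} [NormedAddCommGroup H] [InnerProductSpace ℂ H]

theorem ofReal_smul_nonneg {c : ℝ} (hc : 0 ≤ c) {T : H →L[ℂ] H} (hT : 0 ≤ T) :
    0 ≤ (c : ℂ) • T := by
  rw [ContinuousLinearMap.nonneg_iff_isPositive] at hT ⊢
  exact hT.smul_of_nonneg (by exact_mod_cast hc)

variable [CompleteSpace H]

theorem IsPOVM.le_one_sub {M : ℕ} {Λ : Fin M → H →L[ℂ] H} (h : IsPOVM Λ) {m m' : Fin M}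
    (hm : m ≠ m') : Λ m ≤ 1 - Λ m' := by
  rw [le_sub_iff_add_le, ← h.2, ← Finset.sum_pair hm]
  exact Finset.sum_le_sum_of_subset_of_nonneg (Finset.subset_univ _) fun j _ _ => h.1 j

theorem IsPOVM.le_one {M : ℕ} {Λ : Fin M → H →L[ℂ] H} (h : IsPOVM Λ) (m : Fin M) : Λ m ≤ 1 := by
  rw [← h.2]
  exact Finset.single_le_sum (fun j _ => h.1 j) (Finset.mem_univ m)

theorem opTrace_smul (c : ℂ) (T : H →L[ℂ] H) : opTrace (c • T) = c * opTrace T := by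
  simp [opTrace, tsum_mul_left]

theorem sqrt_ofReal_smul {c : ℝ} (hc : 0 ≤ c) {T : H →L[ℂ] H} (hT : 0 ≤ T) :
    CFC.sqrt ((c : ℂ) • T) = ((√c : ℝ) : ℂ) • CFC.sqrt T := by
  refine CFC.sqrt_unique ?_ (ofReal_smul_nonneg (Real.sqrt_nonneg c) (CFC.sqrt_nonneg T))
  rw [smul_mul_smul_comm, CFC.sqrt_mul_sqrt_self T hT, ← Complex.ofReal_mul, Real.mul_self_sqrt hc]

theorem traceNorm_ofReal_smul {c : ℝ} (hc : 0 ≤ c) (T : H →L[ℂ] H) :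
    traceNorm ((c : ℂ) • T) = c * traceNorm T := by
  have h : star ((c : ℂ) • T) * ((c : ℂ) • T) = ((c * c : ℝ) : ℂ) • (star T * T) := by
    rw [star_smul, smul_mul_smul_comm, Complex.ofReal_mul]
    simp
  rw [traceNorm, h, sqrt_ofReal_smul (mul_nonneg hc hc) (star_mul_self_nonneg T),
    Real.sqrt_mul_self hc, opTrace_smul, Complex.re_ofReal_mul, traceNorm]

theorem mul_mul_sq_add_le {p q X Y : ℝ} (hX : 0 ≤ X) (hY : 0 ≤ Y) :
    p * q * (√X + √Y) ^ 2 ≤ (p + q) * (p * X + q * Y) := by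
  have h : (p + q) * (p * √X ^ 2 + q * √Y ^ 2) - p * q * (√X + √Y) ^ 2 =
      (p * √X - q * √Y) ^ 2 := by ring
  rw [Real.sq_sqrt hX, Real.sq_sqrt hY] at h
  linarith [sq_nonneg (p * √X - q * √Y)]

namespace QEnsemble

variable {M : ℕ} (S : QEnsemble H M)

theorem nonempty_index (S : QEnsemble H M) : Nonempty (Fin M) := by
  by_contra h
  rw [not_nonempty_iff] at h
  simpa using S.p_sum

/-- The square root of the fidelity of two states of the ensemble. -/
noncomputable def overlap (m m' : Fin M) : ℝ := traceNorm (CFC.sqrt (S.ρ m) * CFC.sqrt (S.ρ m'))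

theorem overlap_nonneg (m m' : Fin M) : 0 ≤ S.overlap m m' :=
  traceNorm_mul_nonneg (S.isState m).isHS_sqrt (S.isState m').isHS_sqrt

theorem overlap_le_one (m m' : Fin M) : S.overlap m m' ≤ 1 := by
  have h := traceNorm_mul_le (S.isState m).isHS_sqrt (S.isState m').isHS_sqrt
  rwa [(S.isState m).hsq_sqrt, (S.isState m').hsq_sqrt, Real.sqrt_one, one_mul] at h

theorem fidelity_eq (m m' : Fin M) : fidelity (S.ρ m) (S.ρ m') = S.overlap m m' ^ 2 := rfl

theorem isHS_opPow_sqrt (m : Fin M) (n : ℕ) : IsHS (opPow (CFC.sqrt (S.ρ m)) n) :=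
  (S.isState m).isHS_sqrt.opPow n

theorem hsq_opPow_sqrt (m : Fin M) (n : ℕ) : hsq (opPow (CFC.sqrt (S.ρ m)) n) = 1 := by
  rw [hsq_opPow, (S.isState m).hsq_sqrt, one_pow]

theorem star_opPow_sqrt (m : Fin M) (n : ℕ) :
    star (opPow (CFC.sqrt (S.ρ m)) n) = opPow (CFC.sqrt (S.ρ m)) n := by
  rw [star_opPow, star_sqrt]

theorem re_opTrace_mul_opPow {n : ℕ} {T : OpPow H n} (hT : 0 ≤ T) (m : Fin M) :
    (opTrace (T * opPow (S.ρ m) n)).re = hsq (CFC.sqrt T * opPow (CFC.sqrt (S.ρ m)) n) := by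
  have h : opPow (S.ρ m) n =
      opPow (CFC.sqrt (S.ρ m)) n * star (opPow (CFC.sqrt (S.ρ m)) n) := by
    rw [star_opPow_sqrt, ← opPow_mul, CFC.sqrt_mul_sqrt_self _ (S.isState m).1]
  rw [h, re_opTrace_mul_star_mul (S.isHS_opPow_sqrt m n), hs_mul_self_eq_hsq hT]

theorem errorProb_eq {n : ℕ} {Λ : Fin M → OpPow H n} (hΛ : IsPOVM Λ) :
    S.errorProb n Λ =
      ∑ m, S.p m * hsq (CFC.sqrt (1 - Λ m) * opPow (CFC.sqrt (S.ρ m)) n) :=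
  Finset.sum_congr rfl fun m _ => by
    rw [S.re_opTrace_mul_opPow (sub_nonneg.2 (hΛ.le_one m))]

theorem errorProb_nonneg {n : ℕ} {Λ : Fin M → OpPow H n} (hΛ : IsPOVM Λ) :
    0 ≤ S.errorProb n Λ := by
  rw [S.errorProb_eq hΛ]
  exact Finset.sum_nonneg fun m _ => mul_nonneg (S.p_pos m).le (hsq_nonneg _)

theorem mul_overlap_pow_le_errorProb {n : ℕ} {Λ : Fin M → OpPow H n} (hΛ : IsPOVM Λ)
    {m m' : Fin M} (hm : m ≠ m') :
    S.p m * S.p m' * (S.overlap m m' ^ n) ^ 2 ≤ (S.p m + S.p m') * S.errorProb n Λ := by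
  set a := opPow (CFC.sqrt (S.ρ m)) n with ha
  set b := opPow (CFC.sqrt (S.ρ m')) n with hb
  have ha' : IsHS a := S.isHS_opPow_sqrt m n
  have hb' : IsHS b := S.isHS_opPow_sqrt m' n
  have hle1 : ∀ {c : OpPow H n}, IsHS c → hsq c = 1 → ∀ {T : OpPow H n}, 0 ≤ T → T ≤ 1 →
      √(hsq (CFC.sqrt T * c)) ≤ 1 := by
    intro c hc hc1 T hT0 hT1
    refine Real.sqrt_le_one.2 ?_
    rw [← hs_mul_self_eq_hsq hT0]
    refine (hs_mul_self_mono hc hT1).trans_eq ?_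
    rw [one_mul, hs_self, hc1]
  set X := hsq (CFC.sqrt (1 - Λ m) * a) with hX
  set Y := hsq (CFC.sqrt (1 - Λ m') * b) with hY
  have hT0 := hΛ.1 m
  have hT1 := hΛ.le_one m
  -- Answering `m` when the state is `m'` is one of the errors counted in `Y`.
  have hY' : hsq (CFC.sqrt (Λ m) * b) ≤ Y := by
    rw [hY, ← hs_mul_self_eq_hsq hT0, ← hs_mul_self_eq_hsq (sub_nonneg.2 (hΛ.le_one m'))]
    exact hs_mul_self_mono hb' (hΛ.le_one_sub hm)
  have h1 : S.overlap m m' ^ n ≤ √X + √Y := by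
    rw [overlap, ← traceNorm_opPow_mul (S.isState m).isHS_sqrt (S.isState m').isHS_sqrt]
    refine (traceNorm_mul_le_of_le_one ha' hb' hT0 hT1).trans ?_
    rw [S.star_opPow_sqrt m n]
    refine add_le_add ?_ ?_
    · exact mul_le_of_le_one_right (Real.sqrt_nonneg _)
        (hle1 hb' (S.hsq_opPow_sqrt m' n) (sub_nonneg.2 hT1) (sub_le_self 1 hT0))
    · refine (mul_le_of_le_one_left (Real.sqrt_nonneg _)
        (hle1 ha' (S.hsq_opPow_sqrt m n) hT0 hT1)).trans (Real.sqrt_le_sqrt hY')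
  have h2 : S.p m * X + S.p m' * Y ≤ S.errorProb n Λ := by
    rw [S.errorProb_eq hΛ, ← Finset.sum_pair (f := fun k => S.p k *
      hsq (CFC.sqrt (1 - Λ k) * opPow (CFC.sqrt (S.ρ k)) n)) hm]
    exact Finset.sum_le_sum_of_subset_of_nonneg (Finset.subset_univ _) fun j _ _ =>
      mul_nonneg (S.p_pos j).le (hsq_nonneg _)
  have hp := S.p_pos m
  have hp' := S.p_pos m'
  calc S.p m * S.p m' * (S.overlap m m' ^ n) ^ 2
      ≤ S.p m * S.p m' * (√X + √Y) ^ 2 := by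
        have := pow_nonneg (S.overlap_nonneg m m') n
        gcongr
    _ ≤ (S.p m + S.p m') * (S.p m * X + S.p m' * Y) :=
        mul_mul_sq_add_le (hsq_nonneg _) (hsq_nonneg _)
    _ ≤ _ := mul_le_mul_of_nonneg_left h2 (by positivity)

theorem smul_opPow_nonneg (m : Fin M) (n : ℕ) : 0 ≤ (S.p m : ℂ) • opPow (S.ρ m) n :=
  ofReal_smul_nonneg (S.p_pos m).le (opPow_nonneg (S.isState m).1 n)

theorem sqrt_smul_opPow (m : Fin M) (n : ℕ) : CFC.sqrt ((S.p m : ℂ) • opPow (S.ρ m) n) =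
    ((√(S.p m) : ℝ) : ℂ) • opPow (CFC.sqrt (S.ρ m)) n := by
  rw [sqrt_ofReal_smul (S.p_pos m).le (opPow_nonneg (S.isState m).1 n),
    sqrt_opPow (S.isState m).1]

theorem exists_isPGM (n : ℕ) : ∃ Λ : Fin M → OpPow H n, S.IsPGM n Λ := by
  obtain ⟨m₀⟩ := S.nonempty_index
  exact exists_isPrettyGoodMeasurement (fun m => S.smul_opPow_nonneg m n) m₀

theorem two_mul_errorProb_le {n : ℕ} {Λ : Fin M → OpPow H n} (hΛ : S.IsPGM n Λ) :
    2 * S.errorProb n Λ ≤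
      ∑ m, ∑ j ∈ Finset.univ.erase m, √(S.p m) * √(S.p j) * S.overlap m j ^ n := by
  rw [errorProb, Finset.mul_sum]
  refine Finset.sum_le_sum fun m _ => ?_
  have h := IsPrettyGoodMeasurement.re_opTrace_le hΛ (fun m => S.smul_opPow_nonneg m n)
    (fun m => by
      rw [S.sqrt_smul_opPow]
      exact (S.isHS_opPow_sqrt m n).smul _) m
  rw [mul_smul_comm, opTrace_smul, Complex.re_ofReal_mul] at h
  refine h.trans_eq (Finset.sum_congr rfl fun j _ => ?_)
  rw [S.sqrt_smul_opPow, S.sqrt_smul_opPow, smul_mul_smul_comm, ← Complex.ofReal_mul,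
    traceNorm_ofReal_smul (by positivity),
    traceNorm_opPow_mul (S.isState m).isHS_sqrt (S.isState j).isHS_sqrt, overlap]

theorem minErrorProb_le {n : ℕ} {Λ : Fin M → OpPow H n} (hΛ : IsPOVM Λ) :
    S.minErrorProb n ≤ S.errorProb n Λ :=
  csInf_le ⟨0, by rintro _ ⟨Λ', h, rfl⟩; exact S.errorProb_nonneg h⟩ ⟨Λ, hΛ, rfl⟩

theorem mul_overlap_pow_le_minErrorProb (n : ℕ) {m m' : Fin M} (hm : m ≠ m') :
    S.p m * S.p m' * (S.overlap m m' ^ n) ^ 2 ≤ (S.p m + S.p m') * S.minErrorProb n := by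
  have hp : 0 < S.p m + S.p m' := add_pos (S.p_pos m) (S.p_pos m')
  rw [← div_le_iff₀' hp]
  -- A real infimum is bounded below by `le_csInf` only over a nonempty set; the pretty-good
  -- measurement is a member.
  obtain ⟨Λ, hΛ⟩ := S.exists_isPGM n
  refine le_csInf ⟨_, Λ, hΛ.1, rfl⟩ ?_
  rintro _ ⟨Λ', h, rfl⟩
  rw [div_le_iff₀' hp]
  exact S.mul_overlap_pow_le_errorProb h hm

end QEnsemble

end Ensemble

/-! ### Extended logarithmic quotients as power inequalities. -/

section Quotients

theorem EReal.zero_le_natCast (n : ℕ) : (0 : EReal) ≤ n := by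
  rw [← EReal.coe_coe_eq_natCast]
  exact EReal.coe_nonneg.2 n.cast_nonneg

theorem EReal.coe_ennreal_natCast (n : ℕ) : ((n : ENNReal) : EReal) = n := by
  rw [← ENNReal.ofReal_natCast, EReal.coe_ennreal_ofReal, max_eq_left n.cast_nonneg,
    EReal.coe_coe_eq_natCast]

namespace QEnsemble

theorem quot_log_le_iff {X G : ENNReal} (hG0 : G ≠ 0) (hG1 : G ≤ 1) (n : ℕ) :
    quot (ENNReal.log X) (-ENNReal.log G) ≤ (n : EReal) ↔ X ≤ G⁻¹ ^ n := by
  rw [← ENNReal.log_inv]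
  rcases hG1.eq_or_lt with rfl | hG1
  -- Zero denominator: the quotient is `log X * ⊤`, at most `n` exactly when `log X ≤ 0`.
  · simp only [inv_one, ENNReal.log_one, quot, if_true, one_pow]
    rw [← ENNReal.log_le_zero_iff]
    refine ⟨fun h => ?_, fun h => ?_⟩
    · by_contra! h0
      rw [EReal.mul_top_of_pos h0, top_le_iff] at h
      exact EReal.natCast_ne_top n h
    · exact (mul_nonpos_of_nonpos_of_nonneg h le_top).trans (EReal.zero_le_natCast n)
  · have h1 : 0 < ENNReal.log G⁻¹ := by
      rw [ENNReal.zero_lt_log_iff]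
      exact ENNReal.one_lt_inv.2 hG1
    have h2 : ENNReal.log G⁻¹ ≠ ⊤ := by simpa using hG0
    rw [quot, if_neg h1.ne', EReal.div_le_iff_le_mul h1 h2, mul_comm, ← ENNReal.log_pow,
      ENNReal.log_le_log_iff]

theorem quot_log_zero (x : EReal) : quot x (-ENNReal.log 0) = 0 := by
  simp [quot, EReal.div_top]

theorem quot_log_div_le_iff {c e F : ℝ} (he : 0 ≤ e) (hF0 : 0 < F) (hF1 : F ≤ 1)
    (n : ℕ) :
    quot (ENNReal.log (ENNReal.ofReal c / ENNReal.ofReal e)) (-ENNReal.log (ENNReal.ofReal F)) ≤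
      (n : EReal) ↔ c * F ^ n ≤ e := by
  have hF : ENNReal.ofReal F ≠ 0 := by simpa using hF0
  have hFn : ENNReal.ofReal F ^ n ≠ 0 := pow_ne_zero n hF
  have hFt : ENNReal.ofReal F ^ n ≠ ⊤ := ENNReal.pow_ne_top ENNReal.ofReal_ne_top
  rw [quot_log_le_iff hF (by simpa using hF1), ← ENNReal.inv_pow,
    ENNReal.div_le_iff_le_mul (Or.inr (ENNReal.inv_ne_top.2 hFn)) (Or.inl ENNReal.ofReal_ne_top),
    mul_comm, ← div_eq_mul_inv, ENNReal.le_div_iff_mul_le (Or.inl hFn) (Or.inl hFt),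
    ← ENNReal.ofReal_pow hF0.le, ← ENNReal.ofReal_mul' (by positivity),
    ENNReal.ofReal_le_ofReal_iff he]

/-- The factor `2` is absorbed into squares, matching the fidelity as a squared overlap. -/
theorem two_mul_log_div {c e : ℝ} (hc : 0 ≤ c) (he : 0 ≤ e) :
    2 * ENNReal.log (ENNReal.ofReal c / ENNReal.ofReal e) =
      ENNReal.log (ENNReal.ofReal (c ^ 2) / ENNReal.ofReal (e ^ 2)) := by
  rw [ENNReal.ofReal_pow hc, ENNReal.ofReal_pow he, div_eq_mul_inv, div_eq_mul_inv,
    ENNReal.inv_pow, ← mul_pow, ENNReal.log_pow]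
  rfl

end QEnsemble

end Quotients

/-! ### The sample complexity bounds. -/

theorem theorem6 {H : Type u} [NormedAddCommGroup H] [InnerProductSpace ℂ H] [CompleteSpace H]
    [TopologicalSpace.SeparableSpace H] {M : ℕ} (S : QEnsemble H M) (ε : ℝ)
    (hε : ε ∈ Set.Icc (0 : ℝ) 1) :
    S.lowerBound ε ≤ (((S.sampleComplexity ε : ℕ∞) : ENNReal) : EReal) ∧
    S.sampleComplexity ε ≤ S.upperBound ε ∧
    ∀ n : ℕ, S.upperBound ε ≤ (n : ℕ∞) →
      (∃ Λ : Fin M → OpPow H n, S.IsPGM n Λ) ∧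
      ∀ Λ : Fin M → OpPow H n, S.IsPGM n Λ → S.errorProb n Λ ≤ ε := by
  have hε0 : 0 ≤ ε := hε.1
  have hpgm : ∀ n : ℕ, S.upperBound ε ≤ (n : ℕ∞) →
      ∀ Λ : Fin M → OpPow H n, S.IsPGM n Λ → S.errorProb n Λ ≤ ε := by
    intro n hn Λ hΛ
    obtain ⟨m₀⟩ := S.nonempty_index
    have hn1 : n ≠ 0 := by
      have : (1 : ℕ∞) ≤ n := (le_max_left _ _).trans hn
      have : 1 ≤ n := by exact_mod_cast this
      omega
    have hr : S.upperRatio ε ≤ (n : EReal) := by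
      have h1 := ENat.ceil_le.1 ((le_max_right _ _).trans hn)
      have h2 : ((S.upperRatio ε).toENNReal : EReal) ≤ (((n : ℕ∞) : ENNReal) : EReal) :=
        EReal.coe_ennreal_le_coe_ennreal_iff.2 h1
      rw [EReal.coe_toENNReal_eq_max] at h2
      rw [ENat.toENNReal_coe, EReal.coe_ennreal_natCast] at h2
      exact (le_max_right _ _).trans h2
    have hM : (1 : ℝ) ≤ M := by
      exact_mod_cast Fin.pos m₀
    have hpair : ∀ m m' : Fin M, m ≠ m' →
        (M : ℝ) * (M - 1) * (√(S.p m) * √(S.p m') * S.overlap m m' ^ n) ≤ 2 * ε := by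
      intro m m' hm
      -- At zero fidelity the quotient is `0` and says nothing; the claim then rests on `n ≥ 1`.
      rcases (S.overlap_nonneg m m').eq_or_lt with h0 | h0
      · rw [← h0, zero_pow hn1]
        linarith
      have hc : 0 ≤ (M : ℝ) * (M - 1) * √(S.p m) * √(S.p m') := by
        have : (0 : ℝ) ≤ M - 1 := by linarith
        positivity
      have h1 := (le_iSup₂_of_le (f := fun (m m' : Fin M) => ⨆ _ : m ≠ m', QEnsemble.quot
        (2 * ENNReal.log (ENNReal.ofReal ((M : ℝ) * ((M : ℝ) - 1) * √(S.p m) * √(S.p m')) /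
          ENNReal.ofReal (2 * ε)))
        (-ENNReal.log (ENNReal.ofReal (fidelity (S.ρ m) (S.ρ m'))))) m m'
        (le_iSup_of_le hm le_rfl)).trans hr
      rw [QEnsemble.two_mul_log_div hc (by positivity), S.fidelity_eq,
        QEnsemble.quot_log_div_le_iff (by positivity) (by positivity)
          (pow_le_one₀ h0.le (S.overlap_le_one m m'))] at h1
      refine le_of_sq_le_sq ?_ (by positivity)
      calc _ = (M * (M - 1) * √(S.p m) * √(S.p m')) ^ 2 * (S.overlap m m' ^ 2) ^ n := by ring
        _ ≤ _ := h1
    have h2 := S.two_mul_errorProb_le hΛ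
    -- For `M = 1` the factor `M(M-1)` cannot be cancelled, but the double sum is empty.
    rcases hM.eq_or_lt with h1 | h1
    · have hM1 : M = 1 := by exact_mod_cast h1.symm
      subst hM1
      have h3 : ∀ m : Fin 1, Finset.univ.erase m = ∅ := by decide
      simp only [h3, Finset.sum_empty, Finset.sum_const_zero] at h2
      linarith
    · have hK : 0 < (M : ℝ) * (M - 1) := mul_pos (by linarith) (by linarith)
      -- There are `M(M-1)` ordered pairs, each contributing at most `2ε` after scaling by `M(M-1)`.
      have h3 : (M : ℝ) * (M - 1) * (2 * S.errorProb n Λ) ≤ M * (M - 1) * (2 * ε) := by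
        refine (mul_le_mul_of_nonneg_left h2 hK.le).trans ?_
        rw [Finset.mul_sum]
        simp_rw [Finset.mul_sum]
        refine (Finset.sum_le_sum fun m _ => Finset.sum_le_sum fun j hj =>
          hpair m j (Finset.ne_of_mem_erase hj).symm).trans_eq ?_
        simp only [Finset.sum_const, Finset.card_erase_of_mem (Finset.mem_univ _),
          Finset.card_univ, Fintype.card_fin, nsmul_eq_mul]
        rw [Nat.cast_sub (Fin.pos m₀)]
        push_cast
        ring
      linarith [le_of_mul_le_mul_left h3 hK]
  refine ⟨?_, ?_, fun n hn => ⟨S.exists_isPGM n, hpgm n hn⟩⟩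
  · rcases Set.eq_empty_or_nonempty
      ((fun n : ℕ => (n : ℕ∞)) '' {n : ℕ | 1 ≤ n ∧ S.minErrorProb n ≤ ε}) with h | h
    · rw [QEnsemble.sampleComplexity, h, sInf_empty]
      exact le_top
    -- A nonempty set in `ℕ∞` contains its infimum, so the error bound holds at the sample
    -- complexity itself.
    obtain ⟨n, ⟨hn1, hn⟩, hn'⟩ := csInf_mem h
    rw [QEnsemble.sampleComplexity, ← hn', QEnsemble.lowerBound]
    simp only [ENat.toENNReal_coe, EReal.coe_ennreal_natCast]
    refine iSup₂_le fun m m' => iSup_le fun hm => ?_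
    rcases (S.overlap_nonneg m m').eq_or_lt with h0 | h0
    · rw [S.fidelity_eq, ← h0, zero_pow two_ne_zero, ENNReal.ofReal_zero, QEnsemble.quot_log_zero]
      exact EReal.zero_le_natCast n
    have hp : 0 < S.p m + S.p m' := add_pos (S.p_pos m) (S.p_pos m')
    rw [S.fidelity_eq, QEnsemble.quot_log_div_le_iff (by positivity) (by positivity)
      (pow_le_one₀ h0.le (S.overlap_le_one m m')), ← pow_mul, mul_comm 2 n, pow_mul]
    exact (S.mul_overlap_pow_le_minErrorProb n hm).trans (mul_le_mul_of_nonneg_left hn hp.le)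
  · rcases eq_or_ne (S.upperBound ε) ⊤ with h | h
    · rw [h]
      exact le_top
    obtain ⟨n, hn⟩ := ENat.ne_top_iff_exists.1 h
    obtain ⟨Λ, hΛ⟩ := S.exists_isPGM n
    have h1 : 1 ≤ n := by
      have : (1 : ℕ∞) ≤ n := (le_max_left _ _).trans hn.ge
      exact_mod_cast this
    rw [← hn]
    exact sInf_le ⟨n, ⟨h1, (S.minErrorProb_le hΛ.1).trans (hpgm n hn.ge Λ hΛ)⟩, rfl⟩
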